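/- Let $K\subset\mathbb R^2$ be a strongly convex compact set with $C^3$ boundary, i.e. a compact convex set whose boundary is a simple closed curve having a $C^3$ parametrization $\gamma$ by arc length with $\ddot\gamma\neq 0$ everywhere. Let $O\in\mathbb R^2$, let $\alpha\in(-\frac\pi2,\frac\pi2)$, and write $u(\varphi)=(\cos\varphi,\sin\varphi)^\top$ and $J$ for the rotation by $\frac\pi2$. Take $O$ as the origin, and let $p(\varphi)=\max\{\langle X,u(\varphi)\rangle : X\in K\}$ be the support function of $K$, so that $z=pu+p'u'$ parametrizes $\partial K$ and $e=p'u'-p''u$ is the evolute of $\partial K$. An oblique equilibrium of $K$ with respect to $O$ for the angle of inclination $\alpha$ is a point $z(\varphi)\in\partial K$ with $p'(\varphi)=\tan(\alpha)\,p(\varphi)$; let $n_\alpha$ be the number of oblique equilibria, equivalently the number of solutions $\varphi\in[0,2\pi)$ of this equation. Let $p_\alpha:\mathbb R\to\mathbb R$ be a primitive of $p'-\tan(\alpha)p$ with a constant of integration so large that $p_\alpha+p_\alpha''>0$ on $[0,2\pi]$, and let $C_\alpha$ be the (not necessarily closed) curve $\varphi\mapsto p_\alpha(\varphi)u(\varphi)+p_\alpha'(\varphi)u'(\varphi)$,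 $\varphi\in[0,2\pi]$. Its evolute is the closed curve $e_\alpha=e-\tan(\alpha)Jz$. If the curvature of $C_\alpha$ has only finitely many stationary points in $[0,2\pi)$, then $n_\alpha$ is finite and $$n_\alpha=2-2m_\alpha,$$ where $m_\alpha\in\frac12\mathbb Z$ is the generalized winding number of $e_\alpha$ about $O$, which is defined also when $e_\alpha$ passes through $O$: identifying $\mathbb R^2$ with $\mathbb C$ and $O$ with $0$, $$m_\alpha=\lim_{\varepsilon\searrow0}\frac1{2\pi i}\int_{\{\varphi\in[0,2\pi]\,:\,|e_\alpha(\varphi)|>\varepsilon\}}\frac{e_\alpha'(\varphi)}{e_\alpha(\varphi)}\,\mathrm d\varphi,$$ and this limit exists. -/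

import Mathlib

namespace ObliqueEquilibria

/-- The unit vector `u(φ) = (cos φ, sin φ)`. The Euclidean plane is identified with `ℂ`, so that the
rotation `J` by `π/2` is multiplication by `Complex.I`, and `u'(φ) = J u(φ)`. -/
noncomputable def unitVec (φ : ℝ) : ℂ := ⟨Real.cos φ, Real.sin φ⟩

/-- `K` is a strongly convex compact set with boundary of class `C^n`: it is compact and convex, and
its boundary has a (simple, closed) parametrization `γ` by arc length, of class `C^n`, of some
period `L`, whose second derivative does not vanish. -/
def IsStronglyConvexBody (n : ℕ) (K : Set ℂ) : Prop :=
  IsCompact K ∧ Convex ℝ K ∧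
    ∃ (L : ℝ) (γ : ℝ → ℂ), 0 < L ∧ ContDiff ℝ n γ ∧ Function.Periodic γ L ∧
      Set.InjOn γ (Set.Ico 0 L) ∧ Set.range γ = frontier K ∧
      (∀ s, ‖deriv γ s‖ = 1) ∧ ∀ s, deriv (deriv γ) s ≠ 0

/-- The support function `φ ↦ max {⟪X - O, u(φ)⟫ | X ∈ K}` of `K` with respect to the origin `O`. -/
noncomputable def supportFunction (K : Set ℂ) (O : ℂ) (φ : ℝ) : ℝ :=
  sSup ((fun X : ℂ => inner ℝ (X - O) (unitVec φ)) '' K)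

/-- The curve `z = h u + h' u'` with support function `h`, in coordinates with origin `O`. -/
noncomputable def supportCurve (O : ℂ) (h : ℝ → ℝ) (φ : ℝ) : ℂ :=
  O + ((h φ : ℝ) : ℂ) * unitVec φ + ((deriv h φ : ℝ) : ℂ) * (Complex.I * unitVec φ)

/-- The signed curvature `⟪J γ', γ''⟫ / ‖γ'‖ ^ 3` of a parametrized plane curve. -/
noncomputable def curvature (γ : ℝ → ℂ) (t : ℝ) : ℝ :=
  inner ℝ (Complex.I * deriv γ t) (deriv (deriv γ) t) / ‖deriv γ t‖ ^ 3

/-- The evolute (the locus of the centres of curvature) of a parametrized plane curve. -/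
noncomputable def evolute (γ : ℝ → ℂ) (t : ℝ) : ℂ :=
  γ t + ((1 / curvature γ t : ℝ) : ℂ) * (Complex.I * deriv γ t / (‖deriv γ t‖ : ℂ))

/-- `m` is the (generalized) winding number about `w` of the curve `γ : [0, 2π] → ℂ`, which is
allowed to pass through `w`: the Cauchy principal value
`lim_{ε ↘ 0} (2πi)⁻¹ ∫_{|γ - w| > ε} dz / (z - w)`. -/
def HasWindingNumber (γ : ℝ → ℂ) (w : ℂ) (m : ℝ) : Prop :=
  Filter.Tendsto
    (fun ε : ℝ => (2 * (Real.pi : ℂ) * Complex.I)⁻¹ *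
      ∫ φ in {φ : ℝ | φ ∈ Set.Ioc 0 (2 * Real.pi) ∧ ε < ‖γ φ - w‖}, deriv γ φ / (γ φ - w))
    (nhdsWithin 0 (Set.Ioi 0)) (nhds (m : ℂ))

/-- The equilibrium angles in `[0, 2π)` of `K`, with centre of mass `O`, on a line of inclination
`α`: the solutions of `p'(φ) = tan α * p(φ)`. -/
def equilibriumAngles (K : Set ℂ) (O : ℂ) (α : ℝ) : Set ℝ :=
  {φ | φ ∈ Set.Ico 0 (2 * Real.pi) ∧
    deriv (supportFunction K O) φ = Real.tan α * supportFunction K O φ}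

/-- The oblique equilibria of `K` with respect to `O` for the inclination `α`: the boundary points
`z(φ) = p(φ) u(φ) + p'(φ) u'(φ)` with `p'(φ) = tan α * p(φ)`. -/
def obliqueEquilibria (K : Set ℂ) (O : ℂ) (α : ℝ) : Set ℂ :=
  {Z | Z ∈ frontier K ∧ ∃ φ : ℝ, Z = supportCurve O (supportFunction K O) φ ∧
    deriv (supportFunction K O) φ = Real.tan α * supportFunction K O φ}

end ObliqueEquilibria

namespace ObliqueEquilibria

/-! ### The rotating unit vector -/

section

open Complex

/-! Put `q = p' - tan α * p`, so that equilibria are the zeros of `q`, and the evolute is `e_α - O =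
(i q - q') u` with `e_α' = -(q + q'') u`. Hence `e_α' / (e_α - O)` has real part half the
logarithmic derivative of `q² + q'²` and imaginary part `F = q (q + q'') / (q² + q'²)`. Over a
superlevel set of `|e_α - O|` the real part integrates to zero by periodicity
(`setIntegral_logDeriv_superlevel`), so only `∫ F` survives in the principal value.

Away from the zeros of `q`, `F` is the derivative of `φ + arctan (q' / q)`. The first term
contributes `2π`; at each zero `q' / q` passes from `-∞` to `+∞`, so the arctangent jumps by `π`.
Thus `∫ F = 2π - π n_α` (`integral_angular_velocity`) and `m_α = 1 - n_α / 2`.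

The delicate zeros are those with `q = q' = 0`, where `e_α` meets `O`. The curvature `1 / (p_α +
p_α'')` is stationary exactly where `q + q'' = 0`, so `q + q''` has isolated zeros. A Sturm-type
comparison with the sine (`logDeriv_lower_bound_of_degenerate_zero`) then shows that `q' / q` blows
up there as at a simple zero, and that zeros of `q` are isolated.

All this needs `p` of class `C³` and one boundary point per normal angle
(`IsStronglyConvexBody.supportFunction_regular`). Instead of the theorem of turning tangents, a
clopen argument shows that the boundary point with normal angle `φ` maximizes `⟪·, u(φ)⟫`. -/

theorem unitVec_eq_exp (φ : ℝ) : unitVec φ = Complex.exp (φ * I) := by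
  apply Complex.ext <;> simp [unitVec, Complex.exp_ofReal_mul_I_re, Complex.exp_ofReal_mul_I_im]

theorem hasDerivAt_unitVec (φ : ℝ) : HasDerivAt unitVec (I * unitVec φ) φ := by
  have h : HasDerivAt (fun x : ℝ => Complex.exp (x * I)) (Complex.exp (φ * I) * (1 * I)) φ :=
    ((Complex.ofRealCLM.hasDerivAt (x := φ)).mul_const I).cexp
  rw [show unitVec = fun x : ℝ => Complex.exp (x * I) from funext unitVec_eq_exp]
  convert h using 1
  ring

theorem contDiff_unitVec {n : ℕ∞} : ContDiff ℝ n unitVec := by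
  rw [show unitVec = fun x : ℝ => Complex.exp (x * I) from funext unitVec_eq_exp]
  exact (Complex.ofRealCLM.contDiff.mul contDiff_const).cexp

theorem unitVec_add (a b : ℝ) : unitVec (a + b) = unitVec a * unitVec b := by
  simp only [unitVec_eq_exp, ← Complex.exp_add]
  push_cast
  ring_nf

theorem unitVec_pi_div_two : unitVec (Real.pi / 2) = I := by
  apply Complex.ext <;> simp [unitVec]

theorem unitVec_pi : unitVec Real.pi = -1 := by
  apply Complex.ext <;> simp [unitVec]

theorem norm_unitVec (φ : ℝ) : ‖unitVec φ‖ = 1 := by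
  rw [unitVec_eq_exp, Complex.norm_exp_ofReal_mul_I]

theorem unitVec_ne_zero (φ : ℝ) : unitVec φ ≠ 0 := by
  rw [unitVec_eq_exp]; exact Complex.exp_ne_zero _

theorem unitVec_eq_iff {a b : ℝ} :
    unitVec a = unitVec b ↔ ∃ k : ℤ, a = b + k * (2 * Real.pi) := by
  rw [unitVec_eq_exp, unitVec_eq_exp, Complex.exp_eq_exp_iff_exists_int]
  refine exists_congr fun k => ?_
  constructor
  · intro h
    have := congrArg Complex.im h
    simpa using this
  · intro h
    rw [h]; push_cast; ring

theorem unitVec_periodic : Function.Periodic unitVec (2 * Real.pi) := fun x =>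
  unitVec_eq_iff.2 ⟨1, by simp⟩

/-! ### The tangent angle of the boundary and its inverse -/

/-- A unit-speed velocity field of class `C²` with nonvanishing derivative has an angle function. -/
theorem exists_angle {v : ℝ → ℂ} (hv : ContDiff ℝ 2 v) (h1 : ∀ s, ‖v s‖ = 1)
    (h2 : ∀ s, deriv v s ≠ 0) :
    ∃ θ : ℝ → ℝ, ContDiff ℝ 2 θ ∧ (∀ s, v s = unitVec (θ s)) ∧ ∀ s, deriv θ s ≠ 0 := by
  have hdv : ∀ s, HasDerivAt v (deriv v s) s := fun s =>
    (hv.differentiable (by norm_num) s).hasDerivAt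
  have hv1 : ContDiff ℝ 1 (deriv v) := ((contDiff_succ_iff_deriv (n := 1)).1 hv).2.2
  set κ : ℝ → ℝ := fun s => inner ℝ (I * v s) (deriv v s) with hκ
  have hκ1 : ContDiff ℝ 1 κ := (contDiff_const.mul (hv.of_le (by norm_num))).inner ℝ hv1
  have horth : ∀ s, inner ℝ (v s) (deriv v s) = 0 := by
    intro s
    have h := (hdv s).inner ℝ (hdv s)
    have h' : (fun t => inner ℝ (v t) (v t)) = fun _ => (1 : ℝ) := by
      funext t; rw [real_inner_self_eq_norm_sq, h1]; norm_num
    rw [h'] at h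
    have := h.unique (hasDerivAt_const s (1 : ℝ))
    rw [real_inner_comm (v s) (deriv v s)] at this
    have h3 := real_inner_comm (v s) (deriv v s)
    linarith
  have hsq : ∀ s, (v s).re * (v s).re + (v s).im * (v s).im = 1 := by
    intro s
    have := Complex.sq_norm (v s)
    rw [h1, Complex.normSq_apply] at this
    linarith
  have hder : ∀ s, deriv v s = κ s * (I * v s) := by
    intro s
    have h := horth s
    have h4 := hsq s
    simp only [hκ, Complex.inner, Complex.mul_re, Complex.conj_re, Complex.conj_im,
      Complex.I_re, Complex.I_im, Complex.mul_im] at h ⊢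
    apply Complex.ext
    · simp
      linear_combination (-(deriv v s).re) * h4 + (v s).re * h
    · simp
      linear_combination (-(deriv v s).im) * h4 + (v s).im * h
  -- The angle is the integral of the curvature `κ`; undoing the rotation by `θ` then leaves a
  -- constant vector.
  set θ : ℝ → ℝ := fun s => (v 0).arg + ∫ t in (0 : ℝ)..s, κ t with hθ
  have hdθ : ∀ s, HasDerivAt θ (κ s) s := fun s =>
    (hκ1.continuous.integral_hasStrictDerivAt 0 s).hasDerivAt.const_add _
  have hdθ' : deriv θ = κ := funext fun s => (hdθ s).deriv
  refine ⟨θ, (contDiff_succ_iff_deriv (n := 1)).2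
    ⟨fun s => (hdθ s).differentiableAt, by simp, by rw [hdθ']; exact hκ1⟩, ?_, ?_⟩
  · have hF : ∀ s, HasDerivAt (fun s => v s * unitVec (-θ s)) 0 s := by
      intro s
      have h := (hdv s).mul ((hasDerivAt_unitVec (-θ s)).scomp s (hdθ s).neg)
      refine h.congr_deriv ?_
      rw [hder]
      simp only [Function.comp, Complex.real_smul, Pi.neg_apply]
      push_cast
      ring
    have hc := is_const_of_deriv_eq_zero (fun s => (hF s).differentiableAt)
      (fun s => (hF s).deriv)
    intro s
    have h0 : v 0 * unitVec (-θ 0) = 1 := by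
      have : θ 0 = (v 0).arg := by simp [hθ]
      have hv0 : v 0 = Complex.exp ((v 0).arg * I) := by
        have h := Complex.norm_mul_exp_arg_mul_I (v 0)
        rw [h1, ofReal_one, one_mul] at h
        exact h.symm
      calc v 0 * unitVec (-θ 0)
          = Complex.exp ((v 0).arg * I) * unitVec (-θ 0) := by rw [← hv0]
        _ = 1 := by rw [this, unitVec_eq_exp, ← Complex.exp_add]; simp
    have h := hc s 0
    rw [h0] at h
    have h3 : unitVec (-θ s) * unitVec (θ s) = 1 := by
      rw [← unitVec_add]; simp [unitVec_eq_exp]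
    calc v s = v s * (unitVec (-θ s) * unitVec (θ s)) := by rw [h3, mul_one]
      _ = unitVec (θ s) := by rw [← mul_assoc, h, one_mul]
  · intro s h
    rw [hdθ'] at h
    apply h2 s
    rw [hder, h]; simp

theorem eq_add_int_mul_of_injOn {E : Type*} {γ : ℝ → E} {L : ℝ} (hL : 0 < L)
    (hper : Function.Periodic γ L) (hinj : Set.InjOn γ (Set.Ico 0 L)) {a b : ℝ}
    (h : γ a = γ b) : ∃ j : ℤ, a = b + j * L := by
  have hm : ∀ x, γ (toIcoMod hL 0 x) = γ x := fun x => by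
    rw [toIcoMod, zsmul_eq_mul]; exact hper.sub_int_mul_eq _
  have ha := toIcoMod_mem_Ico' hL a
  have hb := toIcoMod_mem_Ico' hL b
  have := hinj ha hb (by rw [hm, hm, h])
  refine ⟨toIcoDiv hL 0 a - toIcoDiv hL 0 b, ?_⟩
  have h1 := toIcoMod_add_toIcoDiv_zsmul hL 0 a
  have h2 := toIcoMod_add_toIcoDiv_zsmul hL 0 b
  simp only [zsmul_eq_mul] at h1 h2
  push_cast
  linarith

/-- The boundary of a strongly convex body has a positively curved parametrization by arc length,
with an angle function for its tangent. -/
theorem IsStronglyConvexBody.exists_angle {K : Set ℂ} (hK : IsStronglyConvexBody 3 K) :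
    ∃ (L : ℝ) (γ : ℝ → ℂ) (θ : ℝ → ℝ), 0 < L ∧ Function.Periodic γ L ∧
      (∀ a b, γ a = γ b → ∃ j : ℤ, a = b + j * L) ∧ Set.range γ = frontier K ∧
      ContDiff ℝ 2 θ ∧ (∀ s, HasDerivAt γ (unitVec (θ s)) s) ∧ ∀ s, 0 < deriv θ s := by
  obtain ⟨-, -, L, γ, hL, hγ, hper, hinj, hran, h1, h2⟩ := hK
  have hv : ContDiff ℝ 2 (deriv γ) := ((contDiff_succ_iff_deriv (n := 2)).1 hγ).2.2
  obtain ⟨θ, hθ, hvθ, hne⟩ := ObliqueEquilibria.exists_angle hv h1 h2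
  have hdγ : ∀ s, HasDerivAt γ (unitVec (θ s)) s := fun s => by
    rw [← hvθ]
    exact (hγ.differentiable (by norm_num) s).hasDerivAt
  have hi : ∀ a b, γ a = γ b → ∃ j : ℤ, a = b + j * L := fun a b h =>
    eq_add_int_mul_of_injOn hL hper hinj h
  rcases hasDerivWithinAt_forall_lt_or_forall_gt_of_forall_ne (m := 0) convex_univ
    (fun x _ => (hθ.differentiable (by norm_num) x).hasDerivAt.hasDerivWithinAt)
    (fun x _ => hne x) with hneg | hpos
  -- Negatively curved case: reversing the orientation turns the tangent by `π` and makes the angle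
  -- increase.
  · refine ⟨L, fun s => γ (-s), fun s => θ (-s) + Real.pi, hL, ?_, ?_, ?_, ?_, ?_, ?_⟩
    · intro s
      simp only
      rw [neg_add, ← sub_eq_add_neg]
      exact hper.sub_eq _
    · intro a b h
      obtain ⟨j, hj⟩ := hi _ _ h
      exact ⟨-j, by push_cast; linarith⟩
    · rw [← hran]
      exact (Equiv.neg ℝ).surjective.range_comp γ
    · exact (hθ.comp contDiff_neg).add contDiff_const
    · intro s
      refine ((hdγ (-s)).scomp s (hasDerivAt_neg s)).congr_deriv ?_
      rw [unitVec_add, unitVec_pi]; simp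
    · intro s
      have : HasDerivAt (fun s => θ (-s) + Real.pi) (deriv θ (-s) * -1) s :=
        ((hθ.differentiable (by norm_num) (-s)).hasDerivAt.comp s (hasDerivAt_neg s)).add_const _
      rw [this.deriv]
      have := hneg (-s) trivial
      linarith
  · exact ⟨L, γ, θ, hL, hper, hi, hran, hθ, hdγ, fun s => hpos s trivial⟩

theorem inner_unitVec_unitVec (a b : ℝ) : inner ℝ (unitVec a) (unitVec b) = Real.cos (a - b) := by
  simp [unitVec, Complex.inner, Real.cos_sub, mul_comm]

/-- The inverse of the tangent angle, shifted to give the outer normal angle. -/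
theorem exists_parameter_of_normal {L : ℝ} {γ : ℝ → ℂ} {θ : ℝ → ℝ} (hL : 0 < L)
    (hper : Function.Periodic γ L) (hθ : ContDiff ℝ 2 θ)
    (hγ : ∀ s, HasDerivAt γ (unitVec (θ s)) s) (hpos : ∀ s, 0 < deriv θ s) :
    ∃ (s : ℝ → ℝ) (N : ℕ), 0 < N ∧ ContDiff ℝ 2 s ∧ (∀ φ, θ (s φ) = φ + Real.pi / 2) ∧
      (∀ x, s (θ x - Real.pi / 2) = x) ∧
      ∀ (j : ℤ) φ, s (φ + j * (N * (2 * Real.pi))) = s φ + j * L := by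
  have hdθ : ∀ x, HasDerivAt θ (deriv θ x) x := fun x =>
    (hθ.differentiable (by norm_num) x).hasDerivAt
  have hmono : StrictMono θ := strictMono_of_deriv_pos hpos
  have hv : ∀ x, unitVec (θ (x + L)) = unitVec (θ x) := by
    intro x
    have h := (hγ (x + L)).comp_add_const x L
    rw [show (fun y => γ (y + L)) = γ from funext hper] at h
    exact h.unique (hγ x)
  have hdv : ∀ x, deriv θ (x + L) = deriv θ x := by
    intro x
    have h1 : ∀ y, HasDerivAt (fun y => unitVec (θ y)) (deriv θ y • (I * unitVec (θ y))) y :=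
      fun y => (hasDerivAt_unitVec (θ y)).scomp y (hdθ y)
    have h := (h1 (x + L)).comp_add_const x L
    rw [show (fun y => unitVec (θ (y + L))) = fun y => unitVec (θ y) from funext hv] at h
    have h2 := h.unique (h1 x)
    rw [hv] at h2
    exact smul_left_injective ℝ (mul_ne_zero I_ne_zero (unitVec_ne_zero (θ x))) h2
  obtain ⟨k, hk⟩ := unitVec_eq_iff.1 (hv 0)
  rw [zero_add] at hk
  -- Since `θ'` is `L`-periodic, the increment of `θ` over a period is constant. The turning number
  -- `k` is only known to be positive here.
  have hper' : ∀ x, θ (x + L) = θ x + k * (2 * Real.pi) := by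
    intro x
    have hd : ∀ y, HasDerivAt (fun y => θ (y + L) - θ y) 0 y := fun y =>
      (((hdθ (y + L)).comp_add_const y L).sub (hdθ y)).congr_deriv (by rw [hdv, sub_self])
    have := is_const_of_deriv_eq_zero (fun y => (hd y).differentiableAt)
      (fun y => (hd y).deriv) x 0
    simp only [zero_add] at this
    linarith
  have hkpos : (0 : ℝ) < k := by
    have := hmono hL
    by_contra hcon
    have := Real.pi_pos
    nlinarith
  have hmul : ∀ (n : ℤ) x, θ (x + n * L) = θ x + n * (k * (2 * Real.pi)) := by
    intro n x
    have hg : Function.Periodic (fun x => θ x - x / L * (k * (2 * Real.pi))) L := by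
      intro x
      simp only
      rw [hper']
      field_simp
      ring
    have h := hg.int_mul n x
    have h2 : (x + n * L) / L = x / L + n := by field_simp
    simp only [h2] at h
    linarith
  have hsurj : Function.Surjective θ := by
    intro y
    have hT : 0 < k * (2 * Real.pi) := by positivity
    refine mem_range_of_exists_le_of_exists_ge hθ.continuous
      ⟨0 + ⌊(y - θ 0) / (k * (2 * Real.pi))⌋ * L, ?_⟩ ⟨0 + ⌈(y - θ 0) / (k * (2 * Real.pi))⌉ * L, ?_⟩
    · rw [hmul]
      have := Int.floor_le ((y - θ 0) / (k * (2 * Real.pi)))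
      rw [le_div_iff₀ hT] at this
      linarith
    · rw [hmul]
      have := Int.le_ceil ((y - θ 0) / (k * (2 * Real.pi)))
      rw [div_le_iff₀ hT] at this
      linarith
  set e := (hmono.orderIsoOfSurjective θ hsurj).toHomeomorph with he
  have hes : ContDiff ℝ 2 e.symm :=
    e.contDiff_symm_deriv (f' := deriv θ) (fun x => (hpos x).ne') hdθ hθ
  have h1 : ∀ y, θ (e.symm y) = y := fun y => e.apply_symm_apply y
  have h2 : ∀ x, e.symm (θ x) = x := fun x => e.symm_apply_apply x
  obtain ⟨N, rfl⟩ := Int.eq_ofNat_of_zero_le (a := k) (by exact_mod_cast hkpos.le)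
  refine ⟨fun φ => e.symm (φ + Real.pi / 2), N, by exact_mod_cast hkpos,
    hes.comp (contDiff_id.add contDiff_const), fun φ => h1 _, fun x => ?_, fun j φ => ?_⟩
  · simp only [sub_add_cancel, h2]
  · apply hmono.injective
    rw [h1, hmul, h1]
    push_cast
    ring

/-! ### Maximizers of linear functionals and regularity of the support function -/

theorem mem_frontier_of_isMaxOn_inner {K : Set ℂ} {X : ℂ} {φ : ℝ} (hX : X ∈ K)
    (hmax : ∀ Y ∈ K, inner ℝ Y (unitVec φ) ≤ inner ℝ X (unitVec φ)) : X ∈ frontier K := by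
  refine ⟨subset_closure hX, fun hint => ?_⟩
  rw [mem_interior_iff_mem_nhds] at hint
  have ht : Filter.Tendsto (fun t : ℝ => X + t * unitVec φ) (nhdsWithin 0 (Set.Ioi 0))
      (nhds X) := by
    have : Continuous fun t : ℝ => X + t * unitVec φ := by fun_prop
    have h := this.tendsto 0
    simp only [ofReal_zero, zero_mul, add_zero] at h
    exact h.mono_left nhdsWithin_le_nhds
  obtain ⟨t, htK, ht0⟩ := ((ht.eventually hint).and self_mem_nhdsWithin).exists
  have h := hmax _ htK
  rw [inner_add_left, ← Complex.real_smul, real_inner_smul_left, inner_unitVec_unitVec,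
    sub_self, Real.cos_zero] at h
  have : (0 : ℝ) < t := ht0
  linarith

/-- A boundary point where the linear functional `⟪·, u(φ)⟫` is maximal has outer normal angle `φ`
modulo `2π`. -/
theorem angle_of_isLocalMax_inner {γ : ℝ → ℂ} {θ : ℝ → ℝ} (hθ : ContDiff ℝ 2 θ)
    (hγ : ∀ s, HasDerivAt γ (unitVec (θ s)) s) (hpos : ∀ s, 0 < deriv θ s) {σ φ : ℝ}
    (hmax : IsLocalMax (fun t => inner ℝ (γ t) (unitVec φ)) σ) :
    ∃ k : ℤ, θ σ = φ + k * (2 * Real.pi) + Real.pi / 2 := by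
  have hdθ : ∀ x, HasDerivAt θ (deriv θ x) x := fun x =>
    (hθ.differentiable (by norm_num) x).hasDerivAt
  set f : ℝ → ℝ := fun t => inner ℝ (γ t) (unitVec φ) with hf
  have hd : ∀ t, HasDerivAt f (Real.cos (θ t - φ)) t := by
    intro t
    refine ((hγ t).inner ℝ (hasDerivAt_const t (unitVec φ))).congr_deriv ?_
    rw [inner_zero_right, zero_add, inner_unitVec_unitVec]
  have hd1 : deriv f = fun t => Real.cos (θ t - φ) := funext fun t => (hd t).deriv
  have hd2 : deriv (deriv f) σ = -Real.sin (θ σ - φ) * deriv θ σ := by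
    rw [hd1]
    exact ((hdθ σ).sub_const φ).cos.deriv
  have hcos : Real.cos (θ σ - φ) = 0 := hmax.hasDerivAt_eq_zero (hd σ)
  have hsin : Real.sin (θ σ - φ) = 1 ∨ Real.sin (θ σ - φ) = -1 := by
    have := Real.sin_sq_add_cos_sq (θ σ - φ)
    rw [hcos] at this
    have h : (Real.sin (θ σ - φ) - 1) * (Real.sin (θ σ - φ) + 1) = 0 := by linarith
    exact (mul_eq_zero.1 h).imp (fun h => by linarith) (fun h => by linarith)
  rcases hsin with h | h
  · obtain ⟨n, hn⟩ := Real.sin_eq_one_iff.1 h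
    exact ⟨n, by linarith⟩
  · exfalso
    have hpos2 : 0 < deriv (deriv f) σ := by rw [hd2, h]; simpa using hpos σ
    have hmin := isLocalMin_of_deriv_deriv_pos hpos2 (by rw [hd1]; exact hcos)
      (hd σ).continuousAt
    -- A local maximum that is also a local minimum makes `f` locally constant, contradicting `f'' >
    -- 0`.
    have hconst : f =ᶠ[nhds σ] fun _ => f σ := by
      filter_upwards [hmin, hmax] with x h1 h2 using le_antisymm h2 h1
    have := hconst.deriv.deriv.self_of_nhds
    simp at this
    linarith

/-- Two distinct points would bring an uncountable segment with them. This yields uniqueness of the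
maximizer in a given direction. -/
theorem subsingleton_of_convex_of_countable {E : Type*} [AddCommGroup E] [Module ℝ E]
    {s : Set E} (hs : Convex ℝ s) (hc : s.Countable) : s.Subsingleton := by
  intro x hx y hy
  by_contra hne
  have hinj : Function.Injective (AffineMap.lineMap x y : ℝ →ᵃ[ℝ] E) :=
    AffineMap.lineMap_injective ℝ hne
  have hsub : Set.Icc (0 : ℝ) 1 ⊆ (AffineMap.lineMap x y : ℝ →ᵃ[ℝ] E) ⁻¹' s := fun t ht =>
    hs.lineMap_mem hx hy ht
  have := (hc.preimage_of_injOn hinj.injOn).mono hsub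
  rw [Cardinal.Real.Icc_countable_iff] at this
  norm_num at this

/-- The point with outer normal angle `φ` of a positively curved boundary curve maximizes
`⟪·, u(φ)⟫`. -/
theorem inner_le_inner_of_normal {K : Set ℂ} (hcomp : IsCompact K) (hconv : Convex ℝ K) {L : ℝ}
    {γ : ℝ → ℂ} {θ s : ℝ → ℝ} {N : ℕ} (hper : Function.Periodic γ L)
    (hinj : ∀ a b, γ a = γ b → ∃ j : ℤ, a = b + j * L) (hran : Set.range γ = frontier K)
    (hθ : ContDiff ℝ 2 θ) (hγ : ∀ s, HasDerivAt γ (unitVec (θ s)) s)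
    (hpos : ∀ s, 0 < deriv θ s) (hN : 0 < N) (hs : Continuous s)
    (hθs : ∀ φ, θ (s φ) = φ + Real.pi / 2) (hsθ : ∀ x, s (θ x - Real.pi / 2) = x)
    
    (hsN : ∀ (j : ℤ) φ, s (φ + j * (N * (2 * Real.pi))) = s φ + j * L) (φ : ℝ) {Y : ℂ} (hY : Y ∈ K) :
    inner ℝ Y (unitVec φ) ≤ inner ℝ (γ (s φ)) (unitVec φ) := by
  have hγc : Continuous γ := continuous_iff_continuousAt.2 fun t => (hγ t).continuousAt
  have hu : Continuous unitVec := (contDiff_unitVec (n := 0)).continuous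
  have hγK : ∀ t, γ t ∈ K := fun t => hcomp.isClosed.frontier_subset (hran ▸ Set.mem_range_self t)
  have huk : ∀ (k : ℤ) φ, unitVec (φ + k * (2 * Real.pi)) = unitVec φ := fun k φ =>
    unitVec_eq_iff.2 ⟨k, rfl⟩
  set M : ℝ → ℂ → Prop := fun φ X =>
    X ∈ K ∧ ∀ Y ∈ K, inner ℝ Y (unitVec φ) ≤ inner ℝ X (unitVec φ) with hM
  have hMk : ∀ (k : ℤ) φ X, M (φ + k * (2 * Real.pi)) X ↔ M φ X := fun k φ X => by
    simp only [hM, huk]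
  have hform : ∀ φ X, M φ X → ∃ k : ℤ, X = γ (s (φ + k * (2 * Real.pi))) := by
    intro φ X hX
    have hfr := mem_frontier_of_isMaxOn_inner hX.1 hX.2
    rw [← hran] at hfr
    obtain ⟨σ, rfl⟩ := hfr
    obtain ⟨k, hk⟩ := angle_of_isLocalMax_inner hθ hγ hpos (σ := σ) (φ := φ)
      (Filter.Eventually.of_forall fun t => hX.2 _ (hγK t))
    refine ⟨k, ?_⟩
    have h := hsθ σ
    rw [hk, add_sub_cancel_right] at h
    rw [h]
  have huniq : ∀ φ, {X | M φ X}.Subsingleton := by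
    intro φ
    apply subsingleton_of_convex_of_countable
    · intro X hX Z hZ a b ha hb hab
      refine ⟨hconv hX.1 hZ.1 ha hb hab, fun Y hY => ?_⟩
      rw [inner_add_left, real_inner_smul_left, real_inner_smul_left]
      have h1 := mul_le_mul_of_nonneg_left (hX.2 Y hY) ha
      have h2 := mul_le_mul_of_nonneg_left (hZ.2 Y hY) hb
      have h3 : inner ℝ Y (unitVec φ) = a * inner ℝ Y (unitVec φ) + b * inner ℝ Y (unitVec φ) := by
        rw [← add_mul, hab, one_mul]
      linarith
    · refine (Set.countable_range fun k : ℤ => γ (s (φ + k * (2 * Real.pi)))).mono ?_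
      intro X hX
      obtain ⟨k, hk⟩ := hform φ X hX
      exact ⟨k, hk.symm⟩
  have hexists : ∀ φ, ∃ k : ℤ, M φ (γ (s (φ + k * (2 * Real.pi)))) := by
    intro φ
    obtain ⟨X, hXK, hX⟩ := hcomp.exists_isMaxOn ⟨_, hγK 0⟩
      (f := fun X => inner ℝ X (unitVec φ)) (by fun_prop)
    have hMX : M φ X := ⟨hXK, fun Y hY => hX hY⟩
    obtain ⟨k, rfl⟩ := hform φ X hMX
    exact ⟨k, hMX⟩
  -- The good angles form a closed nonempty set; it remains to show that `A` is open.
  set A : Set ℝ := {φ | M φ (γ (s φ))} with hA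
  have hAclosed : IsClosed A := by
    have : A = ⋂ Y ∈ K, {φ | inner ℝ Y (unitVec φ) ≤ inner ℝ (γ (s φ)) (unitVec φ)} := by
      ext φ
      simp [hA, hM, hγK]
    rw [this]
    refine isClosed_biInter fun Y _ => isClosed_le ?_ ?_
    · exact continuous_const.inner hu
    · exact (hγc.comp hs).inner hu
  -- The maximizer in direction `φ` is `γ (s (φ + 2πr))` for some residue `r` modulo `N`. By
  -- uniqueness and simplicity of the curve only one residue occurs, so the complement of `A` is a
  -- finite union of translates of `A`, hence closed.
  have hcompl : Aᶜ = ⋃ k ∈ Finset.Ico 1 N, (fun φ : ℝ => φ + (k : ℕ) * (2 * Real.pi)) ⁻¹' A := by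
    ext φ
    simp only [Set.mem_compl_iff, Set.mem_iUnion, Set.mem_preimage, Finset.mem_Ico, exists_prop]
    constructor
    · intro hφ
      obtain ⟨k, hk⟩ := hexists φ
      have hNz : (N : ℤ) ≠ 0 := by exact_mod_cast hN.ne'
      obtain ⟨r, hr⟩ := Int.eq_ofNat_of_zero_le (Int.emod_nonneg k hNz)
      have hrN := Int.emod_lt_of_pos k (b := N) (by exact_mod_cast hN)
      have hkr : k = r + N * (k / N) := by rw [← hr]; exact (Int.emod_add_mul_ediv k N).symm
      have hzk : γ (s (φ + k * (2 * Real.pi))) = γ (s (φ + r * (2 * Real.pi))) := by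
        have : φ + (k : ℝ) * (2 * Real.pi) =
            φ + r * (2 * Real.pi) + ((k / N : ℤ) : ℝ) * (N * (2 * Real.pi)) := by
          have : (k : ℝ) = r + N * ((k / N : ℤ) : ℝ) := by exact_mod_cast hkr
          rw [this]; ring
        rw [this, hsN, hper.int_mul _ _]
      rw [hzk] at hk
      have hr0 : r ≠ 0 := by
        rintro rfl
        apply hφ
        simpa [hA] using hk
      refine ⟨r, ⟨by omega, by omega⟩, ?_⟩
      have := (hMk r φ _).2 hk
      simpa [hA] using this
    · rintro ⟨r, ⟨hr1, hr2⟩, hr⟩ hφ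
      have h1 := (hMk r φ _).1 (by simpa [hA] using hr)
      obtain ⟨j, hj⟩ := hinj _ _ (huniq φ h1 hφ)
      rw [← hsN] at hj
      have h2 := congrArg θ hj
      rw [hθs, hθs] at h2
      have h3 : (r : ℝ) * (2 * Real.pi) = (j * N) * (2 * Real.pi) := by linarith
      have h4 := mul_right_cancel₀ (by positivity) h3
      have h5 : (r : ℤ) = j * N := by exact_mod_cast h4
      have h6 : (N : ℤ) ∣ r := ⟨j, by rw [h5]; ring⟩
      have := Nat.le_of_dvd (by omega) (Int.natCast_dvd_natCast.1 h6)
      omega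
  have hAopen : IsOpen A := by
    rw [← isClosed_compl_iff, hcompl]
    refine Set.Finite.isClosed_biUnion (Finset.finite_toSet _) fun k _ => ?_
    exact hAclosed.preimage (by fun_prop)
  have hAne : A.Nonempty := by
    obtain ⟨k, hk⟩ := hexists 0
    exact ⟨_, (hMk k 0 _).2 hk⟩
  have huniv := IsClopen.eq_univ ⟨hAclosed, hAopen⟩ hAne
  exact ((huniv ▸ Set.mem_univ φ : φ ∈ A)).2 Y hY

theorem supportFunction_periodic (K : Set ℂ) (O : ℂ) :
    Function.Periodic (supportFunction K O) (2 * Real.pi) := fun φ => by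
  simp only [supportFunction, unitVec_periodic φ]

/-- Regularity of the support function of a strongly convex body, and of the parametrization of the
boundary by the outer normal angle. -/
theorem IsStronglyConvexBody.supportFunction_regular {K : Set ℂ} (hK : IsStronglyConvexBody 3 K)
    (O : ℂ) :
    ContDiff ℝ 3 (supportFunction K O) ∧
      (∀ φ, supportCurve O (supportFunction K O) φ ∈ frontier K) ∧
      ∀ φ ψ, supportCurve O (supportFunction K O) φ = supportCurve O (supportFunction K O) ψ →
        ∃ k : ℤ, φ = ψ + k * (2 * Real.pi) := by
  obtain ⟨L, γ, θ, hL, hper, hinj, hran, hθ, hγ, hpos⟩ := hK.exists_angle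
  obtain ⟨s, N, hN, hs, hθs, hsθ, hsN⟩ := exists_parameter_of_normal hL hper hθ hγ hpos
  have hmax := fun (φ : ℝ) (Y : ℂ) (hY : Y ∈ K) => inner_le_inner_of_normal hK.1 hK.2.1 hper hinj
    hran hθ hγ hpos hN hs.continuous hθs hsθ hsN φ hY
  have hγK : ∀ t, γ t ∈ K := fun t => hK.1.isClosed.frontier_subset (hran ▸ Set.mem_range_self t)
  have hp : supportFunction K O = fun φ => inner ℝ (γ (s φ) - O) (unitVec φ) := by
    funext φ
    refine IsGreatest.csSup_eq ⟨⟨_, hγK (s φ), rfl⟩, ?_⟩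
    rintro _ ⟨Y, hY, rfl⟩
    simp only [inner_sub_left]
    linarith [hmax φ Y hY]
  have hds : ∀ φ, HasDerivAt s (deriv s φ) φ := fun φ =>
    (hs.differentiable (by norm_num) φ).hasDerivAt
  have hdz : ∀ φ, HasDerivAt (fun φ => γ (s φ)) (deriv s φ • (I * unitVec φ)) φ := by
    intro φ
    have h := (hγ (s φ)).scomp φ (hds φ)
    rwa [hθs, unitVec_add, unitVec_pi_div_two, mul_comm (unitVec φ)] at h
  have hγ2 : ContDiff ℝ 2 γ := by
    refine (contDiff_succ_iff_deriv (n := 1)).2 ⟨fun t => (hγ t).differentiableAt, by simp, ?_⟩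
    rw [show deriv γ = fun t => unitVec (θ t) from funext fun t => (hγ t).deriv]
    exact ((contDiff_unitVec (n := 1)).comp (hθ.of_le (by norm_num)))
  -- The term with `z'` drops out because `z'` is parallel to `u'`. So `p'` is expressed through `γ
  -- ∘ s` itself, which is `C²`, and `p` gains one derivative.
  have hdp : ∀ φ, HasDerivAt (supportFunction K O)
      (inner ℝ (γ (s φ) - O) (I * unitVec φ)) φ := by
    intro φ
    rw [hp]
    refine (((hdz φ).sub_const O).inner ℝ (hasDerivAt_unitVec φ)).congr_deriv ?_
    rw [real_inner_smul_left]
    have : inner ℝ (I * unitVec φ) (unitVec φ) = 0 := by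
      simp [Complex.inner]; ring
    rw [this, mul_zero, add_zero]
  have hcurve : ∀ φ, supportCurve O (supportFunction K O) φ = γ (s φ) := by
    intro φ
    rw [supportCurve, (hdp φ).deriv, hp]
    have h := Real.sin_sq_add_cos_sq φ
    apply Complex.ext
    · simp [Complex.inner, unitVec, Complex.cos_ofReal_re, Complex.sin_ofReal_re]
      linear_combination ((γ (s φ)).re - O.re) * h
    · simp [Complex.inner, unitVec, Complex.cos_ofReal_re, Complex.sin_ofReal_re]
      linear_combination ((γ (s φ)).im - O.im) * h
  refine ⟨?_, fun φ => ?_, fun φ ψ h => ?_⟩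
  · refine (contDiff_succ_iff_deriv (n := 2)).2
      ⟨fun φ => (hdp φ).differentiableAt, by simp, ?_⟩
    rw [show deriv (supportFunction K O) = _ from funext fun φ => (hdp φ).deriv]
    exact ((hγ2.comp hs).sub contDiff_const).inner ℝ
      (contDiff_const.mul (contDiff_unitVec (n := 2)))
  · rw [hcurve, ← hran]
    exact Set.mem_range_self _
  · rw [hcurve, hcurve] at h
    obtain ⟨j, hj⟩ := hinj _ _ h
    refine ⟨j * N, ?_⟩
    rw [← hsN] at hj
    have h4 := congrArg θ hj
    rw [hθs, hθs] at h4
    push_cast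
    linarith

/-! ### Curvature and evolute in terms of the support function -/

section SupportCurve

variable {h h1 h2 : ℝ → ℝ} {O : ℂ}

theorem hasDerivAt_supportCurve (hh : ∀ x, HasDerivAt h (h1 x) x)
    (hh1 : ∀ x, HasDerivAt h1 (h2 x) x) (φ : ℝ) :
    HasDerivAt (supportCurve O h) (((h φ + h2 φ : ℝ) : ℂ) * (I * unitVec φ)) φ := by
  have hd : deriv h = h1 := funext fun x => (hh x).deriv
  have hu := hasDerivAt_unitVec φ
  have := ((((hh φ).ofReal_comp).mul hu).const_add O).add
    (((hh1 φ).ofReal_comp).mul (hu.const_mul I))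
  have hs : supportCurve O h = fun x =>
      (O + ((h x : ℝ) : ℂ) * unitVec x) + ((h1 x : ℝ) : ℂ) * (I * unitVec x) := by
    funext x; rw [supportCurve, hd]
  rw [hs]
  refine this.congr_deriv ?_
  push_cast
  linear_combination (h1 φ : ℂ) * unitVec φ * I_mul_I

theorem curvature_supportCurve (hh : ∀ x, HasDerivAt h (h1 x) x)
    (hh1 : ∀ x, HasDerivAt h1 (h2 x) x) (hh2 : Differentiable ℝ h2) (φ : ℝ) :
    curvature (supportCurve O h) φ = |h φ + h2 φ|⁻¹ := by
  have hd : deriv (supportCurve O h) = fun φ => ((h φ + h2 φ : ℝ) : ℂ) * (I * unitVec φ) :=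
    funext fun φ => (hasDerivAt_supportCurve hh hh1 φ).deriv
  have hd2 : deriv (deriv (supportCurve O h)) φ =
      ((h1 φ + deriv h2 φ : ℝ) : ℂ) * (I * unitVec φ) +
        ((h φ + h2 φ : ℝ) : ℂ) * (I * (I * unitVec φ)) := by
    rw [hd]
    exact ((((hh φ).add (hh2 φ).hasDerivAt).ofReal_comp).mul
      ((hasDerivAt_unitVec φ).const_mul I)).deriv
  have hs := Real.sin_sq_add_cos_sq φ
  have hinner : inner ℝ (I * deriv (supportCurve O h) φ) (deriv (deriv (supportCurve O h)) φ) =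
      (h φ + h2 φ) ^ 2 := by
    rw [hd2, hd]
    simp [Complex.inner, unitVec]
    linear_combination (h φ + h2 φ) ^ 2 * hs
  have hnorm : ‖deriv (supportCurve O h) φ‖ = |h φ + h2 φ| := by
    rw [hd]
    simp only [norm_mul, Complex.norm_real, norm_I, norm_unitVec, Real.norm_eq_abs, mul_one]
  rw [curvature, hinner, hnorm, ← sq_abs]
  rcases eq_or_ne |h φ + h2 φ| 0 with h0 | h0
  · simp [h0]
  · field_simp

/-- The absolute values in the curvature and in the speed cancel. No sign of `h + h2` is needed, and
at its zeros division by zero still gives the right value, so the formula holds on all of `ℝ`. -/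
theorem evolute_supportCurve (hh : ∀ x, HasDerivAt h (h1 x) x)
    (hh1 : ∀ x, HasDerivAt h1 (h2 x) x) (hh2 : Differentiable ℝ h2) (φ : ℝ) :
    evolute (supportCurve O h) φ = O + h1 φ * (I * unitVec φ) - h2 φ * unitVec φ := by
  rw [evolute, curvature_supportCurve hh hh1 hh2, (hasDerivAt_supportCurve hh hh1 φ).deriv,
    supportCurve, (hh φ).deriv]
  simp only [norm_mul, Complex.norm_real, norm_I, norm_unitVec, Real.norm_eq_abs, mul_one,
    one_div, inv_inv]
  have key : ((|h φ + h2 φ| : ℝ) : ℂ) *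
      (I * (((h φ + h2 φ : ℝ) : ℂ) * (I * unitVec φ)) / ((|h φ + h2 φ| : ℝ) : ℂ)) =
      -((h φ + h2 φ : ℝ) : ℂ) * unitVec φ := by
    rcases eq_or_ne (h φ + h2 φ) 0 with h0 | h0
    · simp [h0]
    · have : ((|h φ + h2 φ| : ℝ) : ℂ) ≠ 0 := by simpa using h0
      rw [mul_div_cancel₀ _ this]
      linear_combination ((h φ + h2 φ : ℝ) : ℂ) * unitVec φ * I_mul_I
  rw [key]
  push_cast
  ring

end SupportCurve

end

/-! ### Blow-up of the logarithmic derivative at zeros -/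

section

open Filter Topology Set MeasureTheory

theorem tendsto_div_atTop_of_pos {ι : Type*} {l : Filter ι} {f g : ι → ℝ} {c : ℝ} (hc : 0 < c)
    (hf : Tendsto f l (𝓝 c)) (hg : Tendsto g l (𝓝 0)) (hpos : ∀ᶠ i in l, 0 < g i) :
    Tendsto (fun i => f i / g i) l atTop := by
  have h : Tendsto g l (𝓝[>] 0) := tendsto_nhdsWithin_iff.2 ⟨hg, hpos⟩
  simpa only [div_eq_mul_inv, Function.comp_apply] using
    hf.pos_mul_atTop hc (tendsto_inv_nhdsGT_zero.comp h)

section Oscillation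

variable {q q1 q2 : ℝ → ℝ}

/-- Sturm comparison with `sin (y - x)`: the combinations `q' cos + q sin` and `q' sin - q cos`
vanish at `x` and have derivatives `(q + q'') cos` and `(q + q'') sin`, so both are positive to the
right of `x`. They recombine to `q' > 0`, whence `q > 0`, and the second one is the claimed bound.
-/
theorem logDeriv_lower_bound_of_degenerate_zero (hq : ∀ x, HasDerivAt q (q1 x) x)
    (hq1 : ∀ x, HasDerivAt q1 (q2 x) x) {x δ : ℝ} (hδ : δ ≤ 1) (h0 : q x = 0) (h1 : q1 x = 0)
    (hpos : ∀ y ∈ Ioo x (x + δ), 0 < q y + q2 y) {y : ℝ} (hy : y ∈ Ioo x (x + δ)) :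
    0 < q y ∧ Real.cos (y - x) / Real.sin (y - x) ≤ q1 y / q y := by
  have hcos : ∀ y ∈ Ioo x (x + δ), 0 < Real.cos (y - x) := fun y hy =>
    Real.cos_pos_of_mem_Ioo ⟨by linarith [hy.1, Real.pi_pos], by
      linarith [hy.2, Real.pi_gt_three]⟩
  have hsin : ∀ y ∈ Ioo x (x + δ), 0 < Real.sin (y - x) := fun y hy =>
    Real.sin_pos_of_pos_of_lt_pi (by linarith [hy.1]) (by linarith [hy.2, Real.pi_gt_three])
  have hds : ∀ y, HasDerivAt (fun y => Real.sin (y - x)) (Real.cos (y - x)) y := fun y => by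
    simpa using ((hasDerivAt_id y).sub_const x).sin
  have hdc : ∀ y, HasDerivAt (fun y => Real.cos (y - x)) (-Real.sin (y - x)) y := fun y => by
    simpa using ((hasDerivAt_id y).sub_const x).cos
  have hdh : ∀ y, HasDerivAt (fun y => q1 y * Real.cos (y - x) + q y * Real.sin (y - x))
      ((q y + q2 y) * Real.cos (y - x)) y := fun y =>
    (((hq1 y).mul (hdc y)).add ((hq y).mul (hds y))).congr_deriv (by ring)
  have hdk : ∀ y, HasDerivAt (fun y => q y * Real.cos (y - x) - q1 y * Real.sin (y - x))
      (-((q y + q2 y) * Real.sin (y - x))) y := fun y =>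
    (((hq y).mul (hdc y)).sub ((hq1 y).mul (hds y))).congr_deriv (by ring)
  have hmono : ∀ {f f' : ℝ → ℝ}, (∀ y, HasDerivAt f (f' y) y) →
      (∀ y ∈ Ioo x (x + δ), 0 < f' y) → f x = 0 → ∀ y ∈ Ioo x (x + δ), 0 < f y := by
    intro f f' hf hf' hx y hy
    have : StrictMonoOn f (Icc x (x + δ)) := by
      refine strictMonoOn_of_deriv_pos (convex_Icc _ _)
        (fun z _ => (hf z).continuousAt.continuousWithinAt) fun z hz => ?_
      rw [interior_Icc] at hz
      rw [(hf z).deriv]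
      exact hf' z hz
    have := this (left_mem_Icc.2 (by linarith [hy.1, hy.2])) (Ioo_subset_Icc_self hy) hy.1
    rwa [hx] at this
  have hh := hmono hdh (fun y hy => mul_pos (hpos y hy) (hcos y hy)) (by simp [h0, h1])
  have hk := hmono (fun y => (hdk y).neg)
    (fun y hy => by simpa using mul_pos (hpos y hy) (hsin y hy)) (by simp [h0])
  simp only [Pi.neg_apply] at hk
  have hq1pos : ∀ y ∈ Ioo x (x + δ), 0 < q1 y := by
    intro y hy
    have := Real.sin_sq_add_cos_sq (y - x)
    have h2 := mul_pos (hh y hy) (hcos y hy)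
    have h3 := mul_pos (hk y hy) (hsin y hy)
    have h4 : q1 y = (q1 y * Real.cos (y - x) + q y * Real.sin (y - x)) * Real.cos (y - x) +
      -(q y * Real.cos (y - x) - q1 y * Real.sin (y - x)) * Real.sin (y - x) := by
      linear_combination (-q1 y) * this
    linarith
  have hqpos := hmono hq hq1pos h0 y hy
  refine ⟨hqpos, ?_⟩
  rw [div_le_div_iff₀ (hsin y hy) hqpos]
  linarith [hk y hy]

theorem tendsto_logDeriv_right_of_pos (hq : ∀ x, HasDerivAt q (q1 x) x)
    (hq1 : ∀ x, HasDerivAt q1 (q2 x) x) {x : ℝ} (h0 : q x = 0)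
    (h : 0 < q1 x ∨ q1 x = 0 ∧ ∀ᶠ y in 𝓝[>] x, 0 < q y + q2 y) :
    (∀ᶠ y in 𝓝[>] x, q y ≠ 0) ∧ Tendsto (fun y => q1 y / q y) (𝓝[>] x) atTop := by
  rcases h with h | ⟨h1, h⟩
  · have hpos : ∀ᶠ y in 𝓝[>] x, 0 < q y := by
      have hs : Tendsto (slope q x) (𝓝[>] x) (𝓝 (q1 x)) :=
        (hq x).tendsto_slope.mono_left (nhdsWithin_mono _ fun y hy => ne_of_gt hy)
      filter_upwards [hs.eventually (lt_mem_nhds h), self_mem_nhdsWithin] with y hy hxy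
      have hxy' : x < y := hxy
      rw [slope_def_field, h0, sub_zero] at hy
      exact (div_pos_iff_of_pos_right (by linarith)).1 hy
    refine ⟨hpos.mono fun y hy => hy.ne', ?_⟩
    refine tendsto_div_atTop_of_pos h
      ((hq1 x).continuousAt.tendsto.mono_left nhdsWithin_le_nhds) ?_ hpos
    have := (hq x).continuousAt.tendsto
    rw [h0] at this
    exact this.mono_left nhdsWithin_le_nhds
  · obtain ⟨b, hb, hI⟩ := mem_nhdsGT_iff_exists_Ioo_subset.1 h
    have hb' : x < b := hb
    set δ := min 1 (b - x)
    have hδ : 0 < δ := lt_min one_pos (by linarith)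
    have hsub : ∀ y ∈ Ioo x (x + δ), 0 < q y + q2 y := fun y hy =>
      hI ⟨hy.1, by linarith [hy.2, min_le_right 1 (b - x)]⟩
    -- The cap `δ ≤ 1` keeps sine and cosine of `y - x` positive.
    have hmem : ∀ᶠ y in 𝓝[>] x, y ∈ Ioo x (x + δ) := Ioo_mem_nhdsGT (by linarith)
    have key := fun y hy => logDeriv_lower_bound_of_degenerate_zero hq hq1 (min_le_left 1 (b - x))
      h0 h1 hsub (y := y) hy
    refine ⟨hmem.mono fun y hy => (key y hy).1.ne', ?_⟩
    refine tendsto_atTop_mono' _ (hmem.mono fun y hy => (key y hy).2) ?_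
    refine tendsto_div_atTop_of_pos one_pos ?_ ?_ ?_
    · have : Continuous fun y => Real.cos (y - x) := by fun_prop
      have := this.tendsto x
      rw [sub_self, Real.cos_zero] at this
      exact this.mono_left nhdsWithin_le_nhds
    · have : Continuous fun y => Real.sin (y - x) := by fun_prop
      have := this.tendsto x
      rw [sub_self, Real.sin_zero] at this
      exact this.mono_left nhdsWithin_le_nhds
    · filter_upwards [hmem] with y hy
      exact Real.sin_pos_of_pos_of_lt_pi (by linarith [hy.1])
        (by linarith [hy.2, Real.pi_gt_three, min_le_left 1 (b - x)])

/-- A continuous function is the derivative of its primitive, so Darboux's theorem applies. -/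
theorem forall_neg_or_forall_pos_of_continuous {f : ℝ → ℝ} (hf : Continuous f) {s : Set ℝ}
    (hs : Convex ℝ s) (hne : ∀ y ∈ s, f y ≠ 0) : (∀ y ∈ s, f y < 0) ∨ ∀ y ∈ s, 0 < f y :=
  hasDerivWithinAt_forall_lt_or_forall_gt_of_forall_ne hs
    (fun y _ => (hf.integral_hasStrictDerivAt 0 y).hasDerivAt.hasDerivWithinAt) hne

/-- The quotient `q' / q` is unchanged under `q ↦ -q`, which reduces every sign pattern to the
positive one. -/
theorem tendsto_logDeriv_right (hq : ∀ x, HasDerivAt q (q1 x) x)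
    (hq1 : ∀ x, HasDerivAt q1 (q2 x) x) (hq2 : Continuous q2) {x : ℝ} (h0 : q x = 0)
    (h : ∀ᶠ y in 𝓝[>] x, q y + q2 y ≠ 0) :
    (∀ᶠ y in 𝓝[>] x, q y ≠ 0) ∧ Tendsto (fun y => q1 y / q y) (𝓝[>] x) atTop := by
  have hqc : Continuous q := continuous_iff_continuousAt.2 fun t => (hq t).continuousAt
  have hneg : ∀ x, HasDerivAt (-q) ((-q1) x) x := fun x => (hq x).neg
  have hneg1 : ∀ x, HasDerivAt (-q1) ((-q2) x) x := fun x => (hq1 x).neg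
  have flip : (0 < (-q1) x ∨ (-q1) x = 0 ∧ ∀ᶠ y in 𝓝[>] x, 0 < (-q) y + (-q2) y) →
      (∀ᶠ y in 𝓝[>] x, q y ≠ 0) ∧ Tendsto (fun y => q1 y / q y) (𝓝[>] x) atTop := by
    intro hh
    have := tendsto_logDeriv_right_of_pos hneg hneg1 (by simpa using h0) hh
    simpa only [Pi.neg_apply, neg_div_neg_eq, neg_ne_zero] using this
  rcases lt_trichotomy (q1 x) 0 with h1 | h1 | h1
  · exact flip (Or.inl (by simpa using h1))
  · obtain ⟨b, hb, hI⟩ := mem_nhdsGT_iff_exists_Ioo_subset.1 h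
    have hmem : ∀ᶠ y in 𝓝[>] x, y ∈ Ioo x b := Ioo_mem_nhdsGT hb
    rcases forall_neg_or_forall_pos_of_continuous (hqc.add hq2) (convex_Ioo x b) hI with hs | hs
    · refine flip (Or.inr ⟨by simpa using h1, hmem.mono fun y hy => ?_⟩)
      have := hs y hy
      simp only [Pi.neg_apply, Pi.add_apply] at this ⊢
      linarith
    · exact tendsto_logDeriv_right_of_pos hq hq1 h0 (Or.inr ⟨h1, hmem.mono fun y hy => hs y hy⟩)
  · exact tendsto_logDeriv_right_of_pos hq hq1 h0 (Or.inl h1)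

theorem tendsto_logDeriv_left (hq : ∀ x, HasDerivAt q (q1 x) x)
    (hq1 : ∀ x, HasDerivAt q1 (q2 x) x) (hq2 : Continuous q2) {x : ℝ} (h0 : q x = 0)
    (h : ∀ᶠ y in 𝓝[<] x, q y + q2 y ≠ 0) :
    (∀ᶠ y in 𝓝[<] x, q y ≠ 0) ∧ Tendsto (fun y => q1 y / q y) (𝓝[<] x) atBot := by
  have hneg : Tendsto (fun y : ℝ => -y) (𝓝[>] (-x)) (𝓝[<] x) := by
    simpa using tendsto_neg_nhdsGT_neg (a := x)
  have hneg' : Tendsto (fun y : ℝ => -y) (𝓝[<] x) (𝓝[>] (-x)) := tendsto_neg_nhdsLT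
  obtain ⟨h1, h2⟩ := tendsto_logDeriv_right (q := fun y => q (-y)) (q1 := fun y => -q1 (-y))
    (q2 := fun y => q2 (-y)) (x := -x)
    (fun y => ((hq (-y)).comp y (hasDerivAt_neg y)).congr_deriv (by ring))
    (fun y => (((hq1 (-y)).comp y (hasDerivAt_neg y)).neg).congr_deriv (by ring))
    (hq2.comp continuous_neg) (by simpa using h0) (hneg.eventually h)
  refine ⟨by simpa using hneg'.eventually h1, ?_⟩
  -- Reflection `y ↦ -y` reverses the sign of the logarithmic derivative.
  have h3 := tendsto_neg_atTop_atBot.comp (h2.comp hneg')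
  refine h3.congr fun y => ?_
  simp [neg_div]

end Oscillation

/-! ### Isolated zeros and the integral of the angular velocity -/

theorem eventually_ne_zero_of_periodic {f : ℝ → ℝ} {c : ℝ} (hc : 0 < c)
    (hf : Function.Periodic f c) (hfin : {x | x ∈ Ico 0 c ∧ f x = 0}.Finite) (x : ℝ) :
    ∀ᶠ y in 𝓝[≠] x, f y ≠ 0 := by
  have hS : ({y | f y = 0} ∩ Icc (x - 1) (x + 1)).Finite := by
    refine Set.Finite.subset (Set.Finite.biUnion
      (Set.finite_Icc ⌊(x - 1) / c⌋ ⌊(x + 1) / c⌋)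
      fun k _ => hfin.image fun y => y + k * c) ?_
    rintro y ⟨hy, hy1, hy2⟩
    simp only [mem_iUnion, mem_Icc, mem_image, mem_ofPred_eq, exists_prop]
    refine ⟨⌊y / c⌋, ⟨Int.floor_le_floor (by gcongr), Int.floor_le_floor (by gcongr)⟩,
      y - ⌊y / c⌋ * c, ⟨⟨?_, ?_⟩, ?_⟩, by ring⟩
    · have := Int.floor_le (y / c)
      rw [le_div_iff₀ hc] at this
      linarith
    · have := Int.lt_floor_add_one (y / c)
      rw [div_lt_iff₀ hc] at this
      linarith
    · rw [hf.sub_int_mul_eq]; exact hy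
  have hopen : (({y | f y = 0} ∩ Icc (x - 1) (x + 1)) \ {x})ᶜ ∈ 𝓝 x :=
    (hS.subset sdiff_subset).isClosed.isOpen_compl.mem_nhds (by simp)
  have hI : Icc (x - 1) (x + 1) ∈ 𝓝 x := Icc_mem_nhds (by linarith) (by linarith)
  filter_upwards [mem_nhdsWithin_of_mem_nhds hopen, mem_nhdsWithin_of_mem_nhds hI,
    self_mem_nhdsWithin] with y h1 h2 h3 h4
  exact h1 ⟨⟨h4, h2⟩, h3⟩

theorem finite_zeros_inter_Icc {f : ℝ → ℝ} (hf : ∀ x, ∀ᶠ y in 𝓝[≠] x, f y ≠ 0) (a b : ℝ) :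
    {x | x ∈ Icc a b ∧ f x = 0}.Finite := by
  by_contra hinf
  obtain ⟨x, -, hx⟩ := Set.Infinite.exists_accPt_of_subset_isCompact hinf
    (isCompact_Icc (a := a) (b := b)) fun x hx => hx.1
  rw [accPt_iff_frequently_nhdsNE] at hx
  exact hx ((hf x).mono fun y hy h => hy h.2)

/-- A derivative with isolated zeros of a continuous function is integrable. -/
theorem integrableOn_of_deriv_eventually_ne_zero {g g' : ℝ → ℝ} {a b : ℝ}
    (hc : ContinuousOn g (Icc a b))
    (hd : ∀ x ∈ Icc a b, ∀ᶠ y in 𝓝[≠] x, y ∈ Icc a b → HasDerivAt g (g' y) y ∧ g' y ≠ 0) :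
    IntegrableOn g' (Icc a b) := by
  -- Between zeros `g'` has constant sign, and a derivative of constant sign of a continuous
  -- function is integrable. Compactness globalizes this.
  have key : ∀ {c d : ℝ}, Icc c d ⊆ Icc a b →
      (∀ y ∈ Ioo c d, HasDerivAt g (g' y) y ∧ g' y ≠ 0) → IntegrableOn g' (Ioc c d) := by
    intro c d hcd hI
    rcases hasDerivWithinAt_forall_lt_or_forall_gt_of_forall_ne (m := 0) (convex_Ioo c d)
      (fun y hy => (hI y hy).1.hasDerivWithinAt) (fun y hy => (hI y hy).2) with hs | hs
    · have := intervalIntegral.integrableOn_deriv_of_nonneg (g := -g) (g' := -g')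
        (hc.mono hcd).neg (fun y hy => (hI y hy).1.neg)
        fun y hy => by simpa using (hs y hy).le
      simpa using this.neg
    · exact intervalIntegral.integrableOn_deriv_of_nonneg (hc.mono hcd)
        (fun y hy => (hI y hy).1) fun y hy => (hs y hy).le
  refine LocallyIntegrableOn.integrableOn_isCompact (fun x hx => ?_) isCompact_Icc
  have hR := hd x hx
  rw [← nhdsLT_sup_nhdsGT, eventually_sup] at hR
  obtain ⟨l, hl, hl'⟩ := mem_nhdsLT_iff_exists_Ioo_subset.1 hR.1
  obtain ⟨r, hr, hr'⟩ := mem_nhdsGT_iff_exists_Ioo_subset.1 hR.2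
  have hl0 : l < x := hl
  have hr0 : x < r := hr
  have h1 : IntegrableOn g' (Ioc (max l a) x) := by
    refine key (Icc_subset_Icc (le_max_right _ _) hx.2) fun y hy => ?_
    have hy1 := max_lt_iff.1 hy.1
    exact hl' ⟨hy1.1, hy.2⟩ ⟨hy1.2.le, hy.2.le.trans hx.2⟩
  have h2 : IntegrableOn g' (Ioc x (min r b)) := by
    refine key (Icc_subset_Icc hx.1 (min_le_right _ _)) fun y hy => ?_
    have hy1 := lt_min_iff.1 hy.2
    exact hr' ⟨hy.1, hy1.1⟩ ⟨hx.1.trans hy.1.le, hy1.2.le⟩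
  have h3 : IntegrableOn g' (Icc (max l a) (min r b)) := by
    rw [integrableOn_Icc_iff_integrableOn_Ioc,
      ← Ioc_union_Ioc_eq_Ioc (max_le hl0.le hx.1) (le_min hr0.le hx.2)]
    exact h1.union h2
  refine ⟨_, ?_, h3⟩
  filter_upwards [mem_nhdsWithin_of_mem_nhds (Ioo_mem_nhds hl0 hr0), self_mem_nhdsWithin]
    with y hy hy2
  exact ⟨max_le hy.1.le hy2.1, le_min hy.2.le hy2.2⟩

theorem continuousAt_sign_sub {x z : ℝ} (h : x ≠ z) :
    ContinuousAt (fun y => Real.sign (y - z)) x ∧ HasDerivAt (fun y => Real.sign (y - z)) 0 x := by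
  have : (fun y => Real.sign (y - z)) =ᶠ[𝓝 x] fun _ => Real.sign (x - z) := by
    rcases lt_or_gt_of_ne h with h | h
    · filter_upwards [gt_mem_nhds h] with y hy
      rw [Real.sign_of_neg (by linarith), Real.sign_of_neg (by linarith)]
    · filter_upwards [lt_mem_nhds h] with y hy
      rw [Real.sign_of_pos (by linarith), Real.sign_of_pos (by linarith)]
  exact ⟨continuousAt_const.congr this.symm,
    (hasDerivAt_const x _).congr_of_eventuallyEq this⟩

section Oscillation

variable {q q1 q2 : ℝ → ℝ}

theorem eventually_ne_zero_nhdsNE (hq : ∀ x, HasDerivAt q (q1 x) x)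
    (hq1 : ∀ x, HasDerivAt q1 (q2 x) x) (hq2 : Continuous q2)
    (hρ : ∀ x, ∀ᶠ y in 𝓝[≠] x, q y + q2 y ≠ 0) (x : ℝ) : ∀ᶠ y in 𝓝[≠] x, q y ≠ 0 := by
  rcases eq_or_ne (q x) 0 with h0 | h0
  · have h := hρ x
    rw [← nhdsLT_sup_nhdsGT, eventually_sup] at h ⊢
    exact ⟨(tendsto_logDeriv_left hq hq1 hq2 h0 h.1).1,
      (tendsto_logDeriv_right hq hq1 hq2 h0 h.2).1⟩
  · exact ((hq x).continuousAt.eventually_ne h0).filter_mono nhdsWithin_le_nhds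

/-- The jump of `arctan (q' / q)` at a zero of `q` is `π`. -/
theorem continuousAt_arctan_logDeriv_sub_sign (hq : ∀ x, HasDerivAt q (q1 x) x)
    (hq1 : ∀ x, HasDerivAt q1 (q2 x) x) (hq2 : Continuous q2)
    (hρ : ∀ x, ∀ᶠ y in 𝓝[≠] x, q y + q2 y ≠ 0) {x : ℝ} (h0 : q x = 0) :
    ContinuousAt (fun y => Real.arctan (q1 y / q y) - Real.pi / 2 * Real.sign (y - x)) x := by
  have h := hρ x
  rw [← nhdsLT_sup_nhdsGT, eventually_sup] at h
  rw [continuousAt_iff_punctured_nhds, ← nhdsLT_sup_nhdsGT, tendsto_sup]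
  -- At `x` itself the conventions `a / 0 = 0` and `sign 0 = 0` give the value `0`, which is the
  -- common one-sided limit.
  simp only [h0, div_zero, Real.arctan_zero, sub_self, Real.sign_zero, mul_zero]
  constructor
  · have hl := (tendsto_nhds_of_tendsto_nhdsWithin Real.tendsto_arctan_atBot).comp
      (tendsto_logDeriv_left hq hq1 hq2 h0 h.1).2
    have := hl.add_const (Real.pi / 2)
    rw [neg_add_cancel] at this
    refine this.congr' ?_
    filter_upwards [self_mem_nhdsWithin] with y hy
    have : y < x := hy
    rw [Real.sign_of_neg (by linarith)]
    simp
  · have hl := (tendsto_nhds_of_tendsto_nhdsWithin Real.tendsto_arctan_atTop).comp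
      (tendsto_logDeriv_right hq hq1 hq2 h0 h.2).2
    have := hl.sub_const (Real.pi / 2)
    rw [sub_self] at this
    refine this.congr' ?_
    filter_upwards [self_mem_nhdsWithin] with y hy
    have : x < y := hy
    rw [Real.sign_of_pos (by linarith)]
    simp

theorem hasDerivAt_arctan_logDeriv (hq : ∀ x, HasDerivAt q (q1 x) x)
    (hq1 : ∀ x, HasDerivAt q1 (q2 x) x) {x : ℝ} (h0 : q x ≠ 0) :
    HasDerivAt (fun y => y + Real.arctan (q1 y / q y))
      (q x * (q x + q2 x) / (q x ^ 2 + q1 x ^ 2)) x := by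
  refine ((hasDerivAt_id x).add (((hq1 x).div (hq x) h0).arctan)).congr_deriv ?_
  have h1 : q x ^ 2 + q1 x ^ 2 ≠ 0 := by positivity
  have h2 : 1 + (q1 x / q x) ^ 2 ≠ 0 := by positivity
  simp only [Pi.div_apply]
  field_simp
  ring

/-- The total variation of the angle of `(q, q')`, counted with the rotating frame. -/
theorem integral_angular_velocity (hq : ∀ x, HasDerivAt q (q1 x) x)
    (hq1 : ∀ x, HasDerivAt q1 (q2 x) x) (hq2 : Continuous q2)
    (hρ : ∀ x, ∀ᶠ y in 𝓝[≠] x, q y + q2 y ≠ 0) {c : ℝ} (hc : 0 < c)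
    (hper : q c = q 0) (hper1 : q1 c = q1 0) :
    IntegrableOn (fun x => q x * (q x + q2 x) / (q x ^ 2 + q1 x ^ 2)) (Icc 0 c) ∧
      ∫ x in (0 : ℝ)..c, q x * (q x + q2 x) / (q x ^ 2 + q1 x ^ 2) =
        c - Real.pi * {x | x ∈ Ico 0 c ∧ q x = 0}.ncard := by
  have hne := eventually_ne_zero_nhdsNE hq hq1 hq2 hρ
  set Z := (finite_zeros_inter_Icc hne 0 c).toFinset with hZ
  have hmem : ∀ z, z ∈ Z ↔ z ∈ Icc 0 c ∧ q z = 0 := fun z => by simp [hZ]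
  -- Subtracting a step of height `π` at every zero, including zeros at the end points, leaves a
  -- continuous primitive.
  set B : ℝ → ℝ := fun y => y + Real.arctan (q1 y / q y) -
    ∑ z ∈ Z, Real.pi / 2 * Real.sign (y - z) with hB
  have hderiv : ∀ x ∈ Icc 0 c, q x ≠ 0 →
      HasDerivAt B (q x * (q x + q2 x) / (q x ^ 2 + q1 x ^ 2)) x := by
    intro x hx hx0
    have hs : HasDerivAt (fun y => ∑ z ∈ Z, Real.pi / 2 * Real.sign (y - z))
        (∑ z ∈ Z, Real.pi / 2 * 0) x := by
      refine HasDerivAt.fun_sum fun z hz => ?_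
      have : x ≠ z := by
        rintro rfl
        exact hx0 ((hmem x).1 hz).2
      exact (continuousAt_sign_sub this).2.const_mul _
    exact ((hasDerivAt_arctan_logDeriv hq hq1 hx0).sub hs).congr_deriv (by simp)
  have hcont : ContinuousOn B (Icc 0 c) := by
    intro x hx
    refine ContinuousAt.continuousWithinAt ?_
    by_cases hx0 : q x = 0
    · have hxZ : x ∈ Z := (hmem x).2 ⟨hx, hx0⟩
      have : B = fun y => y + (Real.arctan (q1 y / q y) - Real.pi / 2 * Real.sign (y - x)) -
          ∑ z ∈ Z.erase x, Real.pi / 2 * Real.sign (y - z) := by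
        funext y
        simp only [hB]
        rw [← Finset.add_sum_erase Z _ hxZ]
        ring
      rw [this]
      refine (continuousAt_id.add (continuousAt_arctan_logDeriv_sub_sign hq hq1 hq2 hρ hx0)).sub ?_
      refine tendsto_finsetSum _ fun z hz => ?_
      exact ((continuousAt_sign_sub (Finset.ne_of_mem_erase hz).symm).1.const_mul _)
    · exact (hderiv x hx hx0).continuousAt
  have hint : IntegrableOn (fun x => q x * (q x + q2 x) / (q x ^ 2 + q1 x ^ 2)) (Icc 0 c) := by
    refine integrableOn_of_deriv_eventually_ne_zero hcont fun x _ => ?_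
    filter_upwards [hne x, hρ x] with y hy1 hy2 hy
    exact ⟨hderiv y hy hy1, div_ne_zero (mul_ne_zero hy1 hy2) (by positivity)⟩
  refine ⟨hint, ?_⟩
  have hII : IntervalIntegrable (fun x => q x * (q x + q2 x) / (q x ^ 2 + q1 x ^ 2)) volume 0 c :=
    (intervalIntegrable_iff_integrableOn_Icc_of_le hc.le).2 hint
  rw [integral_eq_of_hasDerivAt_off_countable_of_le B _ hc.le
    (s := Z) Z.countable_toSet hcont (fun x hx => hderiv x (Ioo_subset_Icc_self hx.1) fun h0 =>
      hx.2 ((hmem x).2 ⟨Ioo_subset_Icc_self hx.1, h0⟩)) hII]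
  have hBdiff : B c - B 0 = c - Real.pi / 2 *
      ∑ z ∈ Z, (Real.sign (c - z) + Real.sign z) := by
    simp only [hB, hper, hper1, zero_sub, Real.sign_neg, mul_neg, Finset.sum_neg_distrib,
      Finset.mul_sum, mul_add, Finset.sum_add_distrib]
    ring
  -- An interior zero counts twice, a zero at an end point once. By periodicity `0` and `c` are
  -- zeros together, so the total is twice the number of zeros in `[0, c)`.
  have hsplit : ∀ z ∈ Z, Real.sign (c - z) + Real.sign z =
      (if z ≠ c then 1 else 0) + (if z ≠ 0 then 1 else 0) := by
    intro z hz
    obtain ⟨⟨hz1, hz2⟩, -⟩ := (hmem z).1 hz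
    congr 1
    · split_ifs with h
      · exact Real.sign_of_pos (by have := lt_of_le_of_ne hz2 h; linarith)
      · push Not at h; simp [h]
    · split_ifs with h
      · exact Real.sign_of_pos (lt_of_le_of_ne hz1 (Ne.symm h))
      · push Not at h; simp [h]
  have hcard : ((Z.erase c).card = {x | x ∈ Ico 0 c ∧ q x = 0}.ncard) := by
    rw [← Set.ncard_coe_finset]
    congr 1
    ext z
    simp only [Finset.coe_erase, Set.mem_sdiff, Finset.mem_coe, hmem, mem_singleton_iff, mem_ofPred_eq,
      mem_Icc, mem_Ico]
    constructor
    · rintro ⟨⟨⟨h1, h2⟩, h3⟩, h4⟩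
      exact ⟨⟨h1, lt_of_le_of_ne h2 h4⟩, h3⟩
    · rintro ⟨⟨h1, h2⟩, h3⟩
      exact ⟨⟨⟨h1, h2.le⟩, h3⟩, h2.ne⟩
  have hcard0 : (Z.erase 0).card = (Z.erase c).card := by
    by_cases h0 : q 0 = 0
    · rw [Finset.card_erase_of_mem ((hmem 0).2 ⟨⟨le_rfl, hc.le⟩, h0⟩),
        Finset.card_erase_of_mem ((hmem c).2 ⟨⟨hc.le, le_rfl⟩, hper.trans h0⟩)]
    · rw [Finset.erase_eq_of_notMem fun h => h0 ((hmem 0).1 h).2,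
        Finset.erase_eq_of_notMem fun h => h0 (hper.symm.trans ((hmem c).1 h).2)]
  rw [hBdiff, Finset.sum_congr rfl hsplit, Finset.sum_add_distrib, Finset.sum_boole,
    Finset.sum_boole, Finset.filter_ne', Finset.filter_ne', hcard0, hcard]
  ring

end Oscillation

/-! ### Truncated integrals for the principal value -/

/-- Such points are isolated in this set. They are the only places where `max f c` can fail to be
differentiable, and countably many are harmless for the fundamental theorem of calculus. -/
theorem countable_level_of_deriv_ne_zero {f f' : ℝ → ℝ} (hf : ∀ x, HasDerivAt f (f' x) x)
    (c : ℝ) : {x | f x = c ∧ f' x ≠ 0}.Countable := by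
  refine (countable_setOfPred_isolated_right_within (s := {x | f x = c ∧ f' x ≠ 0})).mono ?_
  intro x hx
  refine ⟨hx, ?_⟩
  rw [← eventually_false_iff_eq_bot]
  have h := (hf x).eventually_ne (c := c) hx.2
  filter_upwards [nhdsWithin_mono x (fun y hy => ne_of_gt hy.2) h, self_mem_nhdsWithin]
    with y h1 h2
  exact h1 h2.1.1

theorem hasDerivAt_max_const {f : ℝ → ℝ} {f' c x : ℝ} (hf : HasDerivAt f f' x)
    (h : f x = c → f' = 0) :
    HasDerivAt (fun y => max (f y) c) (if c < f x then f' else 0) x := by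
  rcases lt_trichotomy (f x) c with h1 | h1 | h1
  · rw [if_neg (not_lt.2 h1.le)]
    refine (hasDerivAt_const x c).congr_of_eventuallyEq ?_
    filter_upwards [hf.continuousAt.eventually (gt_mem_nhds h1)] with y hy
    exact max_eq_right hy.le
  · rw [if_neg (not_lt.2 h1.le)]
    rw [h h1] at hf
    rw [hasDerivAt_iff_isLittleO] at hf ⊢
    refine Asymptotics.IsBigO.trans_isLittleO (Asymptotics.IsBigO.of_bound 1 ?_) hf
    refine Eventually.of_forall fun y => ?_
    simp only [h1, max_self, smul_zero, sub_zero, Real.norm_eq_abs, one_mul]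
    rcases le_total (f y) c with hy | hy
    · rw [max_eq_right hy, sub_self, abs_zero]
      exact abs_nonneg _
    · rw [max_eq_left hy]
  · rw [if_pos h1]
    refine hf.congr_of_eventuallyEq ?_
    filter_upwards [hf.continuousAt.eventually (lt_mem_nhds h1)] with y hy
    exact max_eq_left hy.le

/-- The logarithmic derivative of a function with equal values at the end points has zero integral
over its superlevel sets. -/
theorem setIntegral_logDeriv_superlevel {f f' : ℝ → ℝ} (hf : ∀ x, HasDerivAt f (f' x) x)
    (hf' : Continuous f') {a b c : ℝ} (hab : a ≤ b) (hc : 0 < c) (hfab : f b = f a) :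
    IntegrableOn (fun x => f' x / f x) {x | x ∈ Ioc a b ∧ c < f x} ∧
      ∫ x in {x | x ∈ Ioc a b ∧ c < f x}, f' x / f x = 0 := by
  have hfc : Continuous f := continuous_iff_continuousAt.2 fun t => (hf t).continuousAt
  have hmc : Continuous fun x => max (f x) c := hfc.max continuous_const
  have hmpos : ∀ x, 0 < max (f x) c := fun x => lt_max_of_lt_right hc
  have hms : MeasurableSet {x | c < f x} := measurableSet_lt measurable_const hfc.measurable
  have hind : ({x | c < f x}.indicator fun x => f' x / f x) =
      {x | c < f x}.indicator fun x => f' x / max (f x) c := by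
    refine indicator_congr fun x hx => ?_
    rw [max_eq_left (le_of_lt hx)]
  have hint : IntervalIntegrable ({x | c < f x}.indicator fun x => f' x / f x) volume a b := by
    rw [hind, intervalIntegrable_iff_integrableOn_Ioc_of_le hab]
    exact (((hf'.div hmc fun x => (hmpos x).ne').continuousOn.integrableOn_Icc).mono_set
      Ioc_subset_Icc_self).indicator hms
  have hset : {x | x ∈ Ioc a b ∧ c < f x} = Ioc a b ∩ {x | c < f x} := rfl
  constructor
  · rw [hset, inter_comm]
    exact (integrableOn_indicator_iff hms).1
      ((intervalIntegrable_iff_integrableOn_Ioc_of_le hab).1 hint)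
  -- The truncated integrand is the derivative, off a countable set, of `log (max f c)`, which has
  -- equal values at `a` and `b`.
  · rw [hset, ← setIntegral_indicator hms, ← intervalIntegral.integral_of_le hab,
      integral_eq_of_hasDerivAt_off_countable_of_le (fun x => Real.log (max (f x) c)) _ hab
        (countable_level_of_deriv_ne_zero hf c)
        (hmc.log fun x => (hmpos x).ne').continuousOn ?_ hint, hfab, sub_self]
    intro x hx
    have h0 : f x = c → f' x = 0 := fun h => by
      by_contra hne
      exact hx.2 ⟨h, hne⟩
    refine ((hasDerivAt_max_const (hf x) h0).log (hmpos x).ne').congr_deriv ?_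
    by_cases hcx : c < f x
    · rw [indicator_of_mem (by exact hcx), if_pos hcx, max_eq_left hcx.le]
    · rw [indicator_of_notMem (by exact hcx), if_neg hcx, zero_div]

/-- Truncating an integral to the superlevel sets of a function that vanishes only where the
integrand does. -/
theorem tendsto_setIntegral_superlevel {F g : ℝ → ℝ} {a b : ℝ} (hF : IntegrableOn F (Ioc a b))
    (hg : Continuous g) (hFg : ∀ x, g x ≤ 0 → F x = 0) :
    Tendsto (fun ε => ∫ x in {x | x ∈ Ioc a b ∧ ε < g x}, F x) (𝓝[>] 0)
      (𝓝 (∫ x in Ioc a b, F x)) := by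
  have hms : ∀ ε : ℝ, MeasurableSet {x | ε < g x} := fun ε =>
    measurableSet_lt measurable_const hg.measurable
  have heq : ∀ ε : ℝ, ∫ x in {x | x ∈ Ioc a b ∧ ε < g x}, F x =
      ∫ x in Ioc a b, {x | ε < g x}.indicator F x := fun ε => by
    rw [setIntegral_indicator (hms ε)]
    rfl
  simp only [heq]
  refine tendsto_integral_filter_of_dominated_convergence (fun x => ‖F x‖) ?_ ?_ hF.norm ?_
  · exact Eventually.of_forall fun ε => (hF.indicator (hms ε)).aestronglyMeasurable
  · exact Eventually.of_forall fun ε => Eventually.of_forall fun x => norm_indicator_le_norm_self _ _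
  · refine Eventually.of_forall fun x => ?_
    by_cases hx : g x ≤ 0
    · have h0 := hFg x hx
      refine tendsto_const_nhds.congr fun ε => ?_
      by_cases hm : x ∈ {x | ε < g x}
      · rw [indicator_of_mem hm]
      · rw [indicator_of_notMem hm, h0]
    · have hev : ∀ᶠ ε in 𝓝[>] (0 : ℝ), ε < g x :=
        nhdsWithin_le_nhds (gt_mem_nhds (not_le.1 hx))
      refine tendsto_const_nhds.congr' ?_
      filter_upwards [hev] with ε hε
      rw [indicator_of_mem (by exact hε)]

/-! ### The generalized winding number -/

section WindingNumber

variable {q q1 q2 : ℝ → ℝ}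

open Complex in
/-- The generalized winding number of a curve `q u' - q' u` about the origin is determined by the
number of zeros of `q`. -/
theorem hasWindingNumber_of_zeros (hq : ∀ x, HasDerivAt q (q1 x) x)
    (hq1 : ∀ x, HasDerivAt q1 (q2 x) x) (hq2 : Continuous q2)
    (hρ : ∀ x, ∀ᶠ y in 𝓝[≠] x, q y + q2 y ≠ 0) (hper : q (2 * Real.pi) = q 0)
    (hper1 : q1 (2 * Real.pi) = q1 0) {e : ℝ → ℂ} {O : ℂ}
    (he : ∀ φ ∈ Icc 0 (2 * Real.pi), e φ - O = (q φ * I - q1 φ) * unitVec φ)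
    (hde : ∀ φ ∈ Icc 0 (2 * Real.pi), deriv e φ = -((q φ + q2 φ : ℝ) : ℂ) * unitVec φ) :
    HasWindingNumber e O
      (1 - ({x | x ∈ Ico 0 (2 * Real.pi) ∧ q x = 0}.ncard : ℝ) / 2) := by
  have hpi : 0 < 2 * Real.pi := by positivity
  have hqc : Continuous q := continuous_iff_continuousAt.2 fun t => (hq t).continuousAt
  have hq1c : Continuous q1 := continuous_iff_continuousAt.2 fun t => (hq1 t).continuousAt
  obtain ⟨hint, hval⟩ := integral_angular_velocity hq hq1 hq2 hρ hpi hper hper1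
  set F : ℝ → ℝ := fun x => q x * (q x + q2 x) / (q x ^ 2 + q1 x ^ 2) with hF
  set f : ℝ → ℝ := fun x => q x ^ 2 + q1 x ^ 2 with hf
  have hfc : Continuous f := by fun_prop
  set f' : ℝ → ℝ := fun x => 2 * (q1 x * (q x + q2 x)) with hf'
  have hdf : ∀ x, HasDerivAt f (f' x) x := fun x =>
    (((hq x).pow 2).add ((hq1 x).pow 2)).congr_deriv (by simp only [hf']; push_cast; ring)
  have hnorm : ∀ φ ∈ Icc 0 (2 * Real.pi), ‖e φ - O‖ = Real.sqrt (f φ) := by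
    intro φ hφ
    rw [he φ hφ, norm_mul, norm_unitVec, mul_one, Complex.norm_eq_sqrt_sq_add_sq]
    congr 1
    simp [hf]
    ring
  have hquot : ∀ φ ∈ Icc 0 (2 * Real.pi), deriv e φ / (e φ - O) =
      ((f' φ / f φ * (1 / 2) : ℝ) : ℂ) + (F φ : ℂ) * I := by
    intro φ hφ
    rw [he φ hφ, hde φ hφ, mul_div_mul_right _ _ (unitVec_ne_zero φ)]
    -- Where the curve meets `O`, both sides are zero by the division convention.
    by_cases h0 : f φ = 0
    · have h1 : q φ = 0 := by simp only [hf] at h0; nlinarith [sq_nonneg (q1 φ)]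
      have h2 : q1 φ = 0 := by simp only [hf] at h0; nlinarith [sq_nonneg (q1 φ)]
      simp [hf', hF, h1, h2]
    · have h1 : ((f φ : ℝ) : ℂ) ≠ 0 := by exact_mod_cast h0
      have h2 : ((f φ : ℝ) : ℂ) = (q φ * I - q1 φ) * (-(q φ * I) - q1 φ) := by
        simp only [hf]; push_cast
        linear_combination (q φ : ℂ) ^ 2 * I_sq
      have h3 : (q φ * I - q1 φ : ℂ) ≠ 0 := by
        intro h; apply h1; rw [h2, h, zero_mul]
      have hFf : F φ = q φ * (q φ + q2 φ) / f φ := rfl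
      rw [hFf]
      push_cast
      rw [div_eq_iff h3]
      field_simp
      simp only [hf', h2]
      push_cast
      ring
  set S : ℝ → Set ℝ := fun ε => {x | x ∈ Ioc 0 (2 * Real.pi) ∧ ε < Real.sqrt (f x)} with hS
  have hFS := tendsto_setIntegral_superlevel (F := F) (g := fun x => Real.sqrt (f x))
    (hint.mono_set Ioc_subset_Icc_self) hfc.sqrt (by
      intro x hx
      have h0 : f x = 0 := (Real.sqrt_eq_zero (by positivity)).1 (le_antisymm hx (Real.sqrt_nonneg _))
      have : F x = q x * (q x + q2 x) / f x := rfl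
      rw [this, h0, div_zero])
  rw [← intervalIntegral.integral_of_le hpi.le, hval] at hFS
  have hpv : ∀ ε : ℝ, 0 < ε →
      ∫ φ in {φ : ℝ | φ ∈ Set.Ioc 0 (2 * Real.pi) ∧ ε < ‖e φ - O‖}, deriv e φ / (e φ - O) =
        ((∫ x in S ε, F x : ℝ) : ℂ) * I := by
    intro ε hε
    have hset : {φ : ℝ | φ ∈ Set.Ioc 0 (2 * Real.pi) ∧ ε < ‖e φ - O‖} = S ε := by
      ext φ
      refine and_congr_right fun hφ => ?_
      rw [hnorm φ (Ioc_subset_Icc_self hφ)]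
    have hset2 : S ε = {x | x ∈ Ioc 0 (2 * Real.pi) ∧ ε ^ 2 < f x} := by
      ext φ
      refine and_congr_right fun hφ => ?_
      rw [Real.lt_sqrt hε.le]
    have hSm : MeasurableSet (S ε) :=
      measurableSet_Ioc.inter (measurableSet_lt measurable_const hfc.sqrt.measurable)
    obtain ⟨hRi, hR0⟩ := setIntegral_logDeriv_superlevel hdf (by fun_prop) hpi.le
      (sq_pos_of_pos hε) (by simp only [hf, hper, hper1])
    rw [← hset2] at hRi hR0
    rw [hset, setIntegral_congr_fun hSm fun φ hφ => hquot φ (Ioc_subset_Icc_self hφ.1),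
      integral_add, integral_mul_const, integral_complex_ofReal, integral_complex_ofReal,
      integral_mul_const, hR0]
    · simp
    · exact (hRi.mul_const _).ofReal
    · exact ((hint.mono_set fun x hx => Ioc_subset_Icc_self hx.1).ofReal).mul_const _
  rw [HasWindingNumber]
  have hlim := ((continuous_ofReal.tendsto _).comp hFS).mul_const I |>.const_mul
    (2 * (Real.pi : ℂ) * I)⁻¹
  have hpi0 : (Real.pi : ℂ) ≠ 0 := by exact_mod_cast Real.pi_ne_zero
  convert hlim.congr' ?_ using 2
  · push_cast
    field_simp
  · filter_upwards [self_mem_nhdsWithin] with ε hε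
    rw [hpv ε hε]
    rfl

end WindingNumber

/-! ### Counting equilibria and stationary curvature -/

theorem periodic_deriv {f : ℝ → ℝ} {c : ℝ} (hf : Function.Periodic f c) :
    Function.Periodic (deriv f) c := fun x => by
  rw [← deriv_comp_add_const, show (fun y => f (y + c)) = f from funext hf]

/-- The oblique equilibria correspond to the equilibrium angles in `[0, 2π)`. -/
theorem obliqueEquilibria_eq_image {K : Set ℂ} {O : ℂ}
    (hfr : ∀ φ, supportCurve O (supportFunction K O) φ ∈ frontier K) (α : ℝ) :
    obliqueEquilibria K O α =
      supportCurve O (supportFunction K O) '' equilibriumAngles K O α := by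
  have hper := supportFunction_periodic K O
  have hper1 := periodic_deriv hper
  have hpi : 0 < 2 * Real.pi := by positivity
  have hcurve : Function.Periodic (supportCurve O (supportFunction K O)) (2 * Real.pi) :=
    fun φ => by simp only [supportCurve, hper φ, hper1 φ, unitVec_periodic φ]
  ext Z
  constructor
  · rintro ⟨-, φ, rfl, hφ⟩
    have hred : ∀ {β : Type} {f : ℝ → β}, Function.Periodic f (2 * Real.pi) →
        f (toIcoMod hpi 0 φ) = f φ := by
      intro β f hf
      rw [toIcoMod, zsmul_eq_mul]
      exact hf.sub_int_mul_eq _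
    exact ⟨toIcoMod hpi 0 φ, ⟨toIcoMod_mem_Ico' hpi φ, by rw [hred hper, hred hper1, hφ]⟩,
      hred hcurve⟩
  · rintro ⟨φ, ⟨-, hφ⟩, rfl⟩
    exact ⟨hfr φ, φ, rfl, hφ⟩

theorem injOn_Ico_of_eq_add_int_mul {β : Type*} {f : ℝ → β} {c : ℝ} (hc : 0 < c)
    (hf : ∀ x y, f x = f y → ∃ k : ℤ, x = y + k * c) : InjOn f (Ico 0 c) := by
  intro x hx y hy hxy
  obtain ⟨k, hk⟩ := hf x y hxy
  have h1 : (k : ℝ) < 1 := by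
    by_contra h
    nlinarith [hx.2, hy.1]
  have h2 : (-1 : ℝ) < k := by
    by_contra h
    nlinarith [hx.1, hy.2]
  have h3 : k < 1 := by exact_mod_cast h1
  have h4 : -1 < k := by exact_mod_cast h2
  have h5 : k = 0 := by omega
  rw [hk, h5]
  simp

theorem deriv_curvature_supportCurve {h h1 h2 h3 : ℝ → ℝ} {O : ℂ}
    (hh : ∀ x, HasDerivAt h (h1 x) x) (hh1 : ∀ x, HasDerivAt h1 (h2 x) x)
    (hh2 : ∀ x, HasDerivAt h2 (h3 x) x) {φ : ℝ} (hpos : 0 < h φ + h2 φ) :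
    deriv (curvature (supportCurve O h)) φ = -(h1 φ + h3 φ) / (h φ + h2 φ) ^ 2 := by
  have hd := (hh φ).add (hh2 φ)
  refine HasDerivAt.deriv ((hd.inv hpos.ne').congr_of_eventuallyEq ?_)
  filter_upwards [hd.continuousAt.eventually (lt_mem_nhds hpos)] with y hy
  rw [curvature_supportCurve hh hh1 fun x => (hh2 x).differentiableAt]
  simp only [Pi.add_apply] at hy
  simp [abs_of_pos hy]

end

end ObliqueEquilibria

/-! ### The main theorem -/

theorem mainTheorem3 (K : Set ℂ) (hK : ObliqueEquilibria.IsStronglyConvexBody 3 K) (O : ℂ)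
    (α : ℝ) (hα : α ∈ Set.Ioo (-(Real.pi / 2)) (Real.pi / 2))
    -- `pα` is a primitive of `p' - tan α * p`, with a constant of integration so large that
    -- `pα + pα''` is positive
    (pα : ℝ → ℝ)
    (hpα : ∀ φ : ℝ, HasDerivAt pα
      (deriv (ObliqueEquilibria.supportFunction K O) φ
        - Real.tan α * ObliqueEquilibria.supportFunction K O φ) φ)
    (hpos : ∀ φ ∈ Set.Icc (0 : ℝ) (2 * Real.pi), 0 < pα φ + deriv (deriv pα) φ)
    -- the curvature of the curve with support function `pα` has finitely many stationary points
    (hfin : {φ : ℝ | φ ∈ Set.Ico 0 (2 * Real.pi) ∧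
      deriv (ObliqueEquilibria.curvature (ObliqueEquilibria.supportCurve O pα)) φ = 0}.Finite) :
    -- the evolute of that curve is `e - tan α * J z`
    (∀ φ ∈ Set.Icc (0 : ℝ) (2 * Real.pi),
      ObliqueEquilibria.evolute (ObliqueEquilibria.supportCurve O pα) φ =
        ObliqueEquilibria.evolute
            (ObliqueEquilibria.supportCurve O (ObliqueEquilibria.supportFunction K O)) φ
          - (Real.tan α : ℂ) * (Complex.I *
            (ObliqueEquilibria.supportCurve O (ObliqueEquilibria.supportFunction K O) φ - O))) ∧
    (ObliqueEquilibria.obliqueEquilibria K O α).Finite ∧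
    (ObliqueEquilibria.equilibriumAngles K O α).Finite ∧
    (ObliqueEquilibria.obliqueEquilibria K O α).ncard =
      (ObliqueEquilibria.equilibriumAngles K O α).ncard ∧
    ∃ mα : ℝ, (∃ k : ℤ, mα = (k : ℝ) / 2) ∧
      ObliqueEquilibria.HasWindingNumber
        (ObliqueEquilibria.evolute (ObliqueEquilibria.supportCurve O pα)) O mα ∧
      ((ObliqueEquilibria.obliqueEquilibria K O α).ncard : ℝ) = 2 - 2 * mα := by
  set p := ObliqueEquilibria.supportFunction K O with hp
  set t := Real.tan α with ht
  obtain ⟨hp3, hfr, hinj⟩ := hK.supportFunction_regular O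
  rw [← hp] at hp3 hfr hinj
  have hpi : 0 < 2 * Real.pi := by positivity
  have hp2 : ContDiff ℝ 2 (deriv p) := ((contDiff_succ_iff_deriv (n := 2)).1 hp3).2.2
  have hp1 : ContDiff ℝ 1 (deriv (deriv p)) := ((contDiff_succ_iff_deriv (n := 1)).1 hp2).2.2
  have hp0 : Continuous (deriv (deriv (deriv p))) := hp1.continuous_deriv (by norm_num)
  have hd : ∀ x, HasDerivAt p (deriv p x) x := fun x =>
    (hp3.differentiable (by norm_num) x).hasDerivAt
  have hd1 : ∀ x, HasDerivAt (deriv p) (deriv (deriv p) x) x := fun x =>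
    (hp2.differentiable (by norm_num) x).hasDerivAt
  have hd2 : ∀ x, HasDerivAt (deriv (deriv p)) (deriv (deriv (deriv p)) x) x := fun x =>
    (hp1.differentiable (by norm_num) x).hasDerivAt
  set q : ℝ → ℝ := fun x => deriv p x - t * p x with hqdef
  set q1 : ℝ → ℝ := fun x => deriv (deriv p) x - t * deriv p x with hq1def
  set q2 : ℝ → ℝ := fun x => deriv (deriv (deriv p)) x - t * deriv (deriv p) x with hq2def
  have hq : ∀ x, HasDerivAt q (q1 x) x := fun x => (hd1 x).sub ((hd x).const_mul t)
  have hq1 : ∀ x, HasDerivAt q1 (q2 x) x := fun x => (hd2 x).sub ((hd1 x).const_mul t)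
  have hq2 : Continuous q2 := hp0.sub (continuous_const.mul hp1.continuous)
  have hpper : Function.Periodic p (2 * Real.pi) :=
    ObliqueEquilibria.supportFunction_periodic K O
  have hpper1 := ObliqueEquilibria.periodic_deriv hpper
  have hpper2 := ObliqueEquilibria.periodic_deriv hpper1
  have hpper3 := ObliqueEquilibria.periodic_deriv hpper2
  have hder : deriv pα = q := funext fun x => (hpα x).deriv
  have hder1 : deriv (deriv pα) = q1 := by rw [hder]; exact funext fun x => (hq x).deriv
  rw [hder1] at hpos
  have hρfin : {x | x ∈ Set.Ico 0 (2 * Real.pi) ∧ q x + q2 x = 0}.Finite := by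
    refine hfin.subset fun x hx => ⟨hx.1, ?_⟩
    rw [ObliqueEquilibria.deriv_curvature_supportCurve hpα hq hq1
      (hpos x (Set.Ico_subset_Icc_self hx.1))]
    change -(q x + q2 x) / _ = 0
    rw [hx.2, neg_zero, zero_div]
  -- Although `pα` need not be periodic, `q + q''` is, so finiteness over one period makes its zeros
  -- isolated on the whole line.
  have hρ := ObliqueEquilibria.eventually_ne_zero_of_periodic (f := fun x => q x + q2 x) hpi
    (fun x => by simp only [hqdef, hq2def, hpper x, hpper1 x, hpper2 x, hpper3 x]) hρfin
  have hev : ∀ φ, ObliqueEquilibria.evolute (ObliqueEquilibria.supportCurve O pα) φ =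
      O + q φ * (Complex.I * ObliqueEquilibria.unitVec φ) -
        q1 φ * ObliqueEquilibria.unitVec φ :=
    ObliqueEquilibria.evolute_supportCurve hpα hq fun x => (hq1 x).differentiableAt
  have hangles : ObliqueEquilibria.equilibriumAngles K O α =
      {x | x ∈ Set.Ico 0 (2 * Real.pi) ∧ q x = 0} := by
    ext x
    simp only [ObliqueEquilibria.equilibriumAngles, ← hp, ← ht, hqdef, sub_eq_zero]
  have hanglesfin : (ObliqueEquilibria.equilibriumAngles K O α).Finite := by
    rw [hangles]
    exact (ObliqueEquilibria.finite_zeros_inter_Icc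
      (ObliqueEquilibria.eventually_ne_zero_nhdsNE hq hq1 hq2 hρ) 0 (2 * Real.pi)).subset
      fun x hx => ⟨Set.Ico_subset_Icc_self hx.1, hx.2⟩
  have himage := ObliqueEquilibria.obliqueEquilibria_eq_image (K := K) (O := O) hfr α
  have hcard : (ObliqueEquilibria.obliqueEquilibria K O α).ncard =
      (ObliqueEquilibria.equilibriumAngles K O α).ncard := by
    rw [himage]
    exact Set.InjOn.ncard_image
      ((ObliqueEquilibria.injOn_Ico_of_eq_add_int_mul hpi hinj).mono fun x hx => hx.1)
  refine ⟨fun φ _ => ?_, himage ▸ hanglesfin.image _, hanglesfin, hcard,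
    1 - ((ObliqueEquilibria.equilibriumAngles K O α).ncard : ℝ) / 2,
    ⟨2 - ((ObliqueEquilibria.equilibriumAngles K O α).ncard : ℤ), by push_cast; ring⟩, ?_,
    by rw [hcard]; ring⟩
  · rw [hev, ObliqueEquilibria.evolute_supportCurve hd hd1 fun x => (hd2 x).differentiableAt,
      ObliqueEquilibria.supportCurve]
    simp only [hqdef, hq1def]
    push_cast
    linear_combination ((t : ℂ) * ((deriv p φ : ℝ) : ℂ) * ObliqueEquilibria.unitVec φ) * Complex.I_mul_I
  · rw [hangles]
    refine ObliqueEquilibria.hasWindingNumber_of_zeros hq hq1 hq2 hρ ?_ ?_ (fun φ _ => ?_)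
      fun φ _ => ?_
    · simpa [hqdef] using by rw [hpper.eq, hpper1.eq]
    · simpa [hq1def] using by rw [hpper1.eq, hpper2.eq]
    · rw [hev]
      ring
    · rw [funext hev]
      have hu := ObliqueEquilibria.hasDerivAt_unitVec φ
      refine HasDerivAt.deriv (((((hq φ).ofReal_comp.mul (hu.const_mul Complex.I)).const_add
        O).sub ((hq1 φ).ofReal_comp.mul hu)).congr_deriv ?_)
      push_cast
      linear_combination ((q φ : ℂ) * ObliqueEquilibria.unitVec φ) * Complex.I_mul_I
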